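/- Let $(\mathbb V,E)$ be the Rado graph, i.e. a countably infinite (simple) graph such that for all disjoint finite $A,B\subseteq\mathbb V$ there is a vertex $v\notin A\cup B$ adjacent to every vertex of $A$ and to no vertex of $B$. A finite set $A\subseteq\mathbb V$ *supports* an element $x$ of a set with an action of $\mathrm{Aut}(\mathbb V,E)$ if $\sigma\bullet x=x$ for every automorphism $\sigma$ that fixes $A$ pointwise. Let $\mathbf{RadoNom}$ be the category of Rado-nominal sets, i.e. sets with an action of $\mathrm{Aut}(\mathbb V,E)$ in which every element has a finite support, and equivariant functions. The sets $1$, $2=\{0,1\}$ and $[0,1]$ carry the trivial action. For a Rado-nominal set $X$ let $2^X$ be the set of its finitely supported subsets, and let $\mathcal P(X)$ be the Rado-nominal set of finitely supported functions $\mu:2^X\to[0,1]$ with $\mu(X)=1$ and $\mu(\biguplus_{i=1}^\infty S_i)=\sum_{i=1}^\infty\mu(S_i)$ for every sequence of disjoint sets $S_i\in 2^X$ having a common finite support. The strong monad $\mathcal P$ on $\mathbf{RadoNom}$ has unit $\eta_X(x)(S)=[x\in S]$ and bind $(\mu\mathbin{>\!\!>\!\!=}k)(S)=\int_X k(x,S)\,\mu(\mathrm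 dx)$, where for finitely supported $f:X\to[0,1]$ the integral $\int f\,\mathrm d\mu$ is the supremum of $\sum_{i=1}^n r_i\,\mu(U_i)$ over all finite families $r_i\in[0,1]$, $U_i\in2^X$ with $\sum_i r_i[-\in U_i]\le f$. Fix $\alpha\in[0,1]$. Let $\nu_\alpha:1\to\mathcal P(\mathbb V)$ be the measure given as follows: if $S\in2^{\mathbb V}$ is supported by $\{a_1,\dots,a_n\}$ (distinct $a_i$) and $v_1,\dots,v_{2^n}$ are vertices outside $\{a_1,\dots,a_n\}$ that realize each of the $2^n$ possible edge relationships with the $a_i$ once, then $$\nu_\alpha(S)=\sum_{j=1}^{2^n}[v_j\in S]\prod_{i=1}^n\bigl(\alpha E(v_j,a_i)+(1-\alpha)(1-E(v_j,a_i))\bigr).$$ Let $\mathsf{bernoulli}:[0,1]\to\mathcal P(2)$ be $\mathsf{bernoulli}(r)=r\cdot\eta(0)+(1-r)\cdot\eta(1)$. A *strong submonad* of $\mathcal P$ is a family of subobjects $\mathcal S(X)\subseteq\mathcal P(X)$ through which every $\eta_X$ factors and such that, for all $f:Z\to\mathcal P(X)$ and $g:Z\times X\to\mathcal P(Y)$ factoring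 through $\mathcal S(X)$ and $\mathcal S(Y)$, the bind $f\mathbin{>\!\!>\!\!=}g:Z\to\mathcal P(Y)$ factors through $\mathcal S(Y)$; strong submonads are ordered by inclusion at every object. **Statement.** There is a least strong submonad $\mathcal P_\alpha$ of $\mathcal P$ through which $\nu_\alpha$ and $\mathsf{bernoulli}$ factor, and $\mathcal P_\alpha$, with the strong monad structure inherited from $\mathcal P$, is - commutative: for all $f:X_1\to\mathcal P_\alpha(X_2)$ and $g:X_1\to\mathcal P_\alpha(X_3)$, $$f\mathbin{>\!\!>\!\!=}\bigl((g\circ\pi_1)\mathbin{>\!\!>\!\!=}(\eta\circ\langle\pi_2\circ\pi_1,\pi_2\rangle)\bigr)=g\mathbin{>\!\!>\!\!=}\bigl((f\circ\pi_1)\mathbin{>\!\!>\!\!=}(\eta\circ\langle\pi_2,\pi_2\circ\pi_1\rangle)\bigr):X_1\to\mathcal P_\alpha(X_2\times X_3);$$ - affine: $\mathcal P_\alpha(1)\to1$ is an isomorphism. -/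

import Mathlib

namespace NominalProb

open CategoryTheory MonoidalCategory CartesianMonoidalCategory
open scoped Pointwise

universe u v w

section StrongMonads

variable {C : Type w} [Category.{v} C] [CartesianMonoidalCategory C]

/-- A strong monad on a category with finite products: objects `T X`, morphisms `η X : X ⟶ T X`, and
functions `bind : C(Z, T X) × C(Z × X, T Y) → C(Z, T Y)`, natural in `Z`, such that `bind` is
associative with unit `η`. -/
structure StrongMonad (C : Type w) [Category.{v} C] [CartesianMonoidalCategory C] where
  obj : C → C
  η : ∀ X : C, X ⟶ obj X
  bind : ∀ {Z X Y : C}, (Z ⟶ obj X) → (Z ⊗ X ⟶ obj Y) → (Z ⟶ obj Y)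
  bind_natural : ∀ {Z' Z X Y : C} (h : Z' ⟶ Z) (f : Z ⟶ obj X) (g : Z ⊗ X ⟶ obj Y),
    h ≫ bind f g = bind (h ≫ f) (h ▷ X ≫ g)
  η_bind : ∀ {Z X Y : C} (f : Z ⟶ X) (g : Z ⊗ X ⟶ obj Y), bind (f ≫ η X) g = lift (𝟙 Z) f ≫ g
  bind_η : ∀ {Z X : C} (f : Z ⟶ obj X), bind f (snd Z X ≫ η X) = f
  bind_assoc : ∀ {Z X Y W : C} (f : Z ⟶ obj X) (g : Z ⊗ X ⟶ obj Y) (h : Z ⊗ Y ⟶ obj W),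
    bind (bind f g) h = bind f (bind g (lift (fst (Z ⊗ X) Y ≫ fst Z X) (snd (Z ⊗ X) Y) ≫ h))

namespace StrongMonad

variable (T : StrongMonad C)

/-- `f` and `g` commute: running `f` then `g` and returning both results is the same as running
`g` then `f`. -/
def Commute {X₁ X₂ X₃ : C} (f : X₁ ⟶ T.obj X₂) (g : X₁ ⟶ T.obj X₃) : Prop :=
  T.bind f (T.bind (fst X₁ X₂ ≫ g)
      (lift (fst (X₁ ⊗ X₂) X₃ ≫ snd X₁ X₂) (snd (X₁ ⊗ X₂) X₃) ≫ T.η (X₂ ⊗ X₃))) =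
    T.bind g (T.bind (fst X₁ X₃ ≫ f)
      (lift (snd (X₁ ⊗ X₃) X₂) (fst (X₁ ⊗ X₃) X₂ ≫ snd X₁ X₃) ≫ T.η (X₂ ⊗ X₃)))

/-- A strong monad is commutative if all morphisms (with a common domain) commute. -/
def IsCommutative : Prop :=
  ∀ {X₁ X₂ X₃ : C} (f : X₁ ⟶ T.obj X₂) (g : X₁ ⟶ T.obj X₃), T.Commute f g

/-- A strong monad is affine if `T 1 ⟶ 1` is an isomorphism. -/
def IsAffine : Prop := IsIso (toUnit (T.obj (𝟙_ C)))

end StrongMonad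

/-- A strong submonad of `T`: subobjects `S X` of `T X`, through which `η` factors, and such that
`bind f g` factors through them whenever `f` and `g` do. -/
@[ext]
structure StrongSubmonad (T : StrongMonad C) where
  obj : ∀ X : C, Subobject (T.obj X)
  η_factors : ∀ X : C, (obj X).Factors (T.η X)
  bind_factors : ∀ {Z X Y : C} (f : Z ⟶ T.obj X) (g : Z ⊗ X ⟶ T.obj Y),
    (obj X).Factors f → (obj Y).Factors g → (obj Y).Factors (T.bind f g)

namespace StrongSubmonad

variable {T : StrongMonad C}

/-- Strong submonads are ordered by inclusion at every object. -/
instance : PartialOrder (StrongSubmonad T) :=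
  PartialOrder.lift StrongSubmonad.obj fun _ _ h => StrongSubmonad.ext h

/-- The strong monad structure that a strong submonad inherits from the ambient monad, through
which the inclusions preserve unit and bind. -/
noncomputable def toStrongMonad (S : StrongSubmonad T) : StrongMonad C where
  obj X := (S.obj X : C)
  η X := (S.obj X).factorThru (T.η X) (S.η_factors X)
  bind {_ X Y} f g := (S.obj Y).factorThru (T.bind (f ≫ (S.obj X).arrow) (g ≫ (S.obj Y).arrow))
    (S.bind_factors _ _ (Subobject.factors_comp_arrow f) (Subobject.factors_comp_arrow g))
  bind_natural h f g := by
    rw [← cancel_mono (S.obj _).arrow]; simp [T.bind_natural]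
  η_bind f g := by
    rw [← cancel_mono (S.obj _).arrow]; simp [T.η_bind]
  bind_η f := by
    rw [← cancel_mono (S.obj _).arrow]; simp [T.bind_η]
  bind_assoc f g h := by
    rw [← cancel_mono (S.obj _).arrow]; simp [T.bind_assoc]

end StrongSubmonad

end StrongMonads

section Supports

variable {V : Type u} (E : SimpleGraph V) {X : Type v} [MulAction (E ≃g E) X]

variable {E} in
/-- The automorphism `σ` restricts to the identity on `A`. -/
def Fixes (σ : E ≃g E) (A : Finset V) : Prop := ∀ a ∈ A, σ a = a

/-- `A` supports `x`: every automorphism fixing `A` pointwise fixes `x`. -/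
def Supports (A : Finset V) (x : X) : Prop := ∀ σ : E ≃g E, Fixes σ A → σ • x = x

/-- `x` has finite support. -/
def FinSupp (x : X) : Prop := ∃ A : Finset V, Supports E A x

/-- `A` supports the function `f` into a set with the discrete action. -/
def Invariant {R : Type w} (A : Finset V) (f : X → R) : Prop :=
  ∀ σ : E ≃g E, Fixes σ A → ∀ x, f (σ • x) = f x

/-- `A` supports the function `f` (for the conjugation action on functions). -/
def SupportsFun {Y : Type w} [MulAction (E ≃g E) Y] (A : Finset V) (f : X → Y) : Prop :=
  ∀ σ : E ≃g E, Fixes σ A → ∀ x, f (σ • x) = σ • f x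

variable {E}

theorem Fixes.inv {σ : E ≃g E} {A : Finset V} (h : Fixes σ A) : Fixes σ⁻¹ A := fun a ha => by
  have := congrArg (σ⁻¹ : E ≃g E) (h a ha)
  rw [← RelIso.mul_apply, inv_mul_cancel, RelIso.one_apply] at this
  exact this.symm

theorem Fixes.mono {σ : E ≃g E} {A B : Finset V} (h : Fixes σ B) (hAB : A ⊆ B) : Fixes σ A :=
  fun a ha => h a (hAB ha)

theorem Supports.mono {A B : Finset V} {x : X} (h : Supports E A x) (hAB : A ⊆ B) :
    Supports E B x := fun σ hσ => h σ (hσ.mono hAB)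

theorem Supports.mem_iff {A : Finset V} {S : Set X} (h : Supports E A S) {σ : E ≃g E}
    (hσ : Fixes σ A) (x : X) : σ • x ∈ S ↔ x ∈ S := by
  conv_lhs => rw [← h σ hσ]
  exact Set.smul_mem_smul_set_iff

theorem supports_set_of {A : Finset V} {S : Set X}
    (h : ∀ σ : E ≃g E, Fixes σ A → ∀ x, x ∈ S → σ • x ∈ S) : Supports E A S := fun σ hσ => by
  ext x
  rw [Set.mem_smul_set_iff_inv_smul_mem]
  refine ⟨fun hx => ?_, fun hx => h _ hσ.inv _ hx⟩
  simpa using h σ hσ _ hx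

theorem fixes_conj {σ τ : E ≃g E} {A : Finset V}
    (h : Fixes τ (A.map σ.toEquiv.toEmbedding)) : Fixes (σ⁻¹ * τ * σ) A := fun a ha => by
  have h1 : τ (σ a) = σ a := h (σ a) (Finset.mem_map_of_mem _ ha)
  rw [RelIso.mul_apply, RelIso.mul_apply, h1, ← RelIso.mul_apply, inv_mul_cancel, RelIso.one_apply]

theorem Supports.smul {A : Finset V} {x : X} (h : Supports E A x) (σ : E ≃g E) :
    Supports E (A.map σ.toEquiv.toEmbedding) (σ • x) := fun τ hτ => by
  have h2 := h _ (fixes_conj hτ)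
  rw [mul_assoc, mul_smul, inv_smul_eq_iff, mul_smul] at h2
  exact h2

variable (E X) in
/-- The internal powerset `2^X`: the finitely supported subsets of `X`. -/
def Event : Type v := {S : Set X // FinSupp E S}

/-- `σ • S = {σ • x | x ∈ S}`. -/
instance : MulAction (E ≃g E) (Event E X) where
  smul σ S := ⟨σ • S.1, S.2.elim fun _ hA => ⟨_, hA.smul σ⟩⟩
  one_smul S := Subtype.ext (one_smul _ S.1)
  mul_smul σ τ S := Subtype.ext (mul_smul σ τ S.1)

@[simp] theorem Event.coe_smul (σ : E ≃g E) (S : Event E X) : (σ • S).1 = σ • S.1 := rfl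

variable (E X) in
/-- The whole set, as an event. -/
def Event.univ : Event E X := ⟨Set.univ, ∅, supports_set_of fun _ _ _ _ => trivial⟩

/-- The σ-algebra of the sets supported by `A`. -/
@[reducible] def supportedSets (E : SimpleGraph V) (X : Type v) [MulAction (E ≃g E) X] (A : Finset V) :
    MeasurableSpace X where
  MeasurableSet' S := Supports E A S
  measurableSet_empty := supports_set_of fun _ _ _ h => h.elim
  measurableSet_compl S h := supports_set_of fun σ hσ x hx => by
    rwa [Set.mem_compl_iff, h.mem_iff hσ]
  measurableSet_iUnion f h := supports_set_of fun σ hσ x hx => by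
    obtain ⟨i, hi⟩ := Set.mem_iUnion.1 hx
    exact Set.mem_iUnion.2 ⟨i, ((h i).mem_iff hσ x).2 hi⟩

theorem supportedSets_mono {A B : Finset V} (h : A ⊆ B) :
    supportedSets E X A ≤ supportedSets E X B := fun _ hS => Supports.mono hS h

theorem Invariant.measurable {R : Type w} [MeasurableSpace R] {A : Finset V} {f : X → R}
    (h : Invariant E A f) : @Measurable X R (supportedSets E X A) _ f := fun t _ =>
  supports_set_of fun σ hσ x hx => by simpa only [Set.mem_preimage, h σ hσ x] using hx

end Supports

section Measures

variable {V : Type u} (E : SimpleGraph V) (X : Type v) [MulAction (E ≃g E) X]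

/-- A finitely supported probability measure on `X`: a finitely supported function
`μ : 2^X → [0,1]` which is internally countably additive (that is, countably additive on
sequences of disjoint sets having a common finite support) and satisfies `μ(X) = 1`. -/
structure FSProb where
  toFun : Event E X → unitInterval
  finSupp' : ∃ A : Finset V, Invariant E A toFun
  additive' : ∀ (S : ℕ → Event E X) (U : Event E X),
    (∃ A : Finset V, ∀ i, Supports E A (S i).1) → Pairwise (fun i j => Disjoint (S i).1 (S j).1) →
    U.1 = ⋃ i, (S i).1 → HasSum (fun i => (toFun (S i) : ℝ)) (toFun U)
  total' : toFun (Event.univ E X) = 1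

variable {E X}

namespace FSProb

instance : CoeFun (FSProb E X) fun _ => Event E X → unitInterval := ⟨toFun⟩

@[ext] theorem ext {μ ν : FSProb E X} (h : ∀ S, μ S = ν S) : μ = ν := by
  cases μ; cases ν; congr; exact funext h

/-- `(σ • μ)(S) = μ(σ⁻¹ • S)`. -/
instance : MulAction (E ≃g E) (FSProb E X) where
  smul σ μ :=
    { toFun := fun S => μ (σ⁻¹ • S)
      finSupp' := by
        obtain ⟨A, hA⟩ := μ.finSupp'
        refine ⟨A.map σ.toEquiv.toEmbedding, fun τ hτ S => ?_⟩
        have := hA _ (fixes_conj hτ) (σ⁻¹ • S)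
        simpa [mul_smul] using this
      additive' := by
        rintro S U ⟨A, hA⟩ hd hU
        refine μ.additive' _ _ ⟨_, fun i => (hA i).smul σ⁻¹⟩ (fun i j hij => ?_) ?_
        · simpa [Set.disjoint_smul_set] using hd hij
        · simp [hU, Set.smul_set_iUnion]
      total' := by
        rw [← μ.total']; congr 1; exact Subtype.ext (Set.smul_set_univ) }
  one_smul μ := by
    ext S; change (μ ((1 : E ≃g E)⁻¹ • S) : ℝ) = μ S; simp
  mul_smul σ τ μ := by
    ext S; change (μ ((σ * τ)⁻¹ • S) : ℝ) = μ (τ⁻¹ • σ⁻¹ • S); simp [mul_smul]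

theorem smul_apply (σ : E ≃g E) (μ : FSProb E X) (S : Event E X) : (σ • μ) S = μ (σ⁻¹ • S) := rfl

theorem finSupp (μ : FSProb E X) : FinSupp E μ := by
  obtain ⟨A, hA⟩ := μ.finSupp'
  exact ⟨A, fun σ hσ => by ext S; rw [smul_apply, hA _ hσ.inv]⟩

theorem empty (μ : FSProb E X) {S : Event E X} (h : S.1 = ∅) : μ S = 0 := by
  have := μ.additive' (fun _ => S) S (S.2.imp fun _ hA _ => hA)
    (fun i j _ => by simp [h]) (by simp [h])
  exact Subtype.ext ((summable_const_iff _).1 this.summable)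

/-- The restriction of `μ` to the σ-algebra of sets supported by `A`. -/
noncomputable def toMeasure (μ : FSProb E X) (A : Finset V) :
    @MeasureTheory.Measure X (supportedSets E X A) :=
  @MeasureTheory.Measure.ofMeasurable X (supportedSets E X A)
    (fun S hS => ENNReal.ofReal (μ ⟨S, A, hS⟩))
    ((congrArg (fun t : unitInterval => ENNReal.ofReal t) (μ.empty rfl)).trans (by simp)) (fun f hf hd => by
      have := μ.additive' (fun i => ⟨f i, A, hf i⟩)
        ⟨⋃ i, f i, A, (supportedSets E X A).measurableSet_iUnion f hf⟩ ⟨A, hf⟩ hd rfl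
      rw [← this.tsum_eq, ENNReal.ofReal_tsum_of_nonneg (fun i => unitInterval.nonneg _)
        this.summable])

theorem toMeasure_apply (μ : FSProb E X) {A : Finset V} {S : Event E X} (hS : Supports E A S.1) :
    μ.toMeasure A S.1 = ENNReal.ofReal (μ S) :=
  @MeasureTheory.Measure.ofMeasurable_apply X (supportedSets E X A) _ _ _ S.1 hS

theorem toMeasure_univ (μ : FSProb E X) (A : Finset V) : μ.toMeasure A Set.univ = 1 := by
  have := μ.toMeasure_apply (A := A) (S := Event.univ E X)
    (supports_set_of fun _ _ _ _ => trivial)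
  rw [μ.total'] at this
  simpa [Event.univ] using this

theorem toMeasure_trim (μ : FSProb E X) {A B : Finset V} (h : A ⊆ B) :
    (μ.toMeasure B).trim (supportedSets_mono h) = μ.toMeasure A := by
  refine @MeasureTheory.Measure.ext X (supportedSets E X A) _ _ fun S hS => ?_
  rw [MeasureTheory.trim_measurableSet_eq _ hS]
  exact (μ.toMeasure_apply (S := ⟨S, A, hS⟩) (Supports.mono hS h)).trans
    (μ.toMeasure_apply (S := ⟨S, A, hS⟩) hS).symm

/-- The integral `∫ f dμ` of a function `f : X → [0,1]`: the supremum of `∑ rᵢ μ(Uᵢ)` over the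
finite simple functions `∑ rᵢ [- ∈ Uᵢ] ≤ f`, with finitely supported `Uᵢ`. -/
noncomputable def integral (μ : FSProb E X) (f : X → unitInterval) : ℝ :=
  sSup {t : ℝ | ∃ (n : ℕ) (r : Fin n → unitInterval) (U : Fin n → Event E X),
    (∀ x, ∑ i, (U i).1.indicator (fun _ => (r i : ℝ)) x ≤ f x) ∧ t = ∑ i, (r i : ℝ) * μ (U i)}

theorem ofReal_sum_simple (μ : FSProb E X) {n : ℕ} (r : Fin n → unitInterval)
    (U : Fin n → Event E X) {A : Finset V} (hA : ∀ i, Supports E A (U i).1) :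
    ENNReal.ofReal (∑ i, (r i : ℝ) * μ (U i)) =
      @MeasureTheory.lintegral X (supportedSets E X A) (μ.toMeasure A)
        (fun x => ENNReal.ofReal (∑ i, (U i).1.indicator (fun _ => (r i : ℝ)) x)) := by
  let _ := supportedSets E X A
  have h1 : ∀ x, ENNReal.ofReal (∑ i, (U i).1.indicator (fun _ => (r i : ℝ)) x) =
      ∑ i, (U i).1.indicator (fun _ => ENNReal.ofReal (r i)) x := fun x => by
    rw [ENNReal.ofReal_sum_of_nonneg
      fun i _ => Set.indicator_nonneg (fun _ _ => unitInterval.nonneg _) _]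
    refine Finset.sum_congr rfl fun i _ => ?_
    by_cases hx : x ∈ (U i).1 <;> simp [hx]
  have hU : ∀ i, MeasurableSet (U i).1 := hA
  simp_rw [h1]
  rw [MeasureTheory.lintegral_finsetSum _ fun i _ => measurable_const.indicator (hU i),
    ENNReal.ofReal_sum_of_nonneg
      fun i _ => mul_nonneg (unitInterval.nonneg _) (unitInterval.nonneg _)]
  refine Finset.sum_congr rfl fun i _ => ?_
  rw [MeasureTheory.lintegral_indicator_const (hU i), ENNReal.ofReal_mul (unitInterval.nonneg _)]
  exact congrArg _ (μ.toMeasure_apply (hA i)).symm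

theorem exists_common_support {ι : Type*} (s : Finset ι) (U : ι → Event E X) (A : Finset V) :
    ∃ B, A ⊆ B ∧ ∀ i ∈ s, Supports E B (U i).1 := by
  classical
  choose D hD using fun i => (U i).2
  exact ⟨A ∪ s.biUnion D, Finset.subset_union_left, fun i hi => (hD i).mono
    ((Finset.subset_biUnion_of_mem D hi).trans Finset.subset_union_right)⟩

theorem lintegral_mono_support (μ : FSProb E X) {f : X → ENNReal} {A B : Finset V}
    (hf : @Measurable X ENNReal (supportedSets E X A) _ f) (h : A ⊆ B) :
    @MeasureTheory.lintegral X (supportedSets E X A) (μ.toMeasure A) f =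
      @MeasureTheory.lintegral X (supportedSets E X B) (μ.toMeasure B) f := by
  rw [← μ.toMeasure_trim h, MeasureTheory.lintegral_trim _ hf]

theorem simple_le (μ : FSProb E X) {f : X → unitInterval} {A : Finset V} (hf : Invariant E A f)
    {n : ℕ} {r : Fin n → unitInterval} {U : Fin n → Event E X}
    (h : ∀ x, ∑ i, (U i).1.indicator (fun _ => (r i : ℝ)) x ≤ f x) :
    ENNReal.ofReal (∑ i, (r i : ℝ) * μ (U i)) ≤
      @MeasureTheory.lintegral X (supportedSets E X A) (μ.toMeasure A)
        (fun x => ENNReal.ofReal (f x)) := by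
  obtain ⟨B, hAB, hB⟩ := exists_common_support Finset.univ U A
  rw [ofReal_sum_simple μ r U fun i => hB i (Finset.mem_univ i), μ.lintegral_mono_support _ hAB]
  · exact MeasureTheory.lintegral_mono fun x => ENNReal.ofReal_le_ofReal (h x)
  · exact (ENNReal.measurable_ofReal.comp measurable_subtype_coe).comp hf.measurable

theorem lintegral_le_one (μ : FSProb E X) (f : X → unitInterval) (A : Finset V) :
    @MeasureTheory.lintegral X (supportedSets E X A) (μ.toMeasure A)
        (fun x => ENNReal.ofReal (f x)) ≤ 1 := by
  let _ := supportedSets E X A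
  calc _ ≤ ∫⁻ _, 1 ∂(μ.toMeasure A) := MeasureTheory.lintegral_mono fun x => by
        simpa using unitInterval.le_one (f x)
    _ = 1 := by simpa using μ.toMeasure_univ A

theorem sum_simple_le_one (μ : FSProb E X) {f : X → unitInterval}
    {n : ℕ} {r : Fin n → unitInterval} {U : Fin n → Event E X}
    (h : ∀ x, ∑ i, (U i).1.indicator (fun _ => (r i : ℝ)) x ≤ f x) :
    ∑ i, (r i : ℝ) * μ (U i) ≤ 1 := by
  have h1 : Invariant E (∅ : Finset V) (fun _ : X => (1 : unitInterval)) := fun _ _ _ => rfl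
  have := (μ.simple_le h1 (fun x => (h x).trans (unitInterval.le_one _))).trans
    (μ.lintegral_le_one _ _)
  simpa using this

theorem bddAbove_simple (μ : FSProb E X) (f : X → unitInterval) :
    BddAbove {t : ℝ | ∃ (n : ℕ) (r : Fin n → unitInterval) (U : Fin n → Event E X),
      (∀ x, ∑ i, (U i).1.indicator (fun _ => (r i : ℝ)) x ≤ f x) ∧
        t = ∑ i, (r i : ℝ) * μ (U i)} := by
  refine ⟨1, ?_⟩
  rintro t ⟨n, r, U, h, rfl⟩
  exact μ.sum_simple_le_one h

theorem integral_nonneg (μ : FSProb E X) (f : X → unitInterval) : 0 ≤ μ.integral f :=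
  le_csSup (μ.bddAbove_simple f)
    ⟨0, Fin.elim0, Fin.elim0, fun x => by simpa using unitInterval.nonneg (f x), by simp⟩

theorem integral_le_one (μ : FSProb E X) (f : X → unitInterval) : μ.integral f ≤ 1 := by
  refine Real.sSup_le ?_ zero_le_one
  rintro t ⟨n, r, U, h, rfl⟩
  exact μ.sum_simple_le_one h

/-- The internal integral of a function supported by `A` is the Lebesgue integral with respect to
the restriction of `μ` to the σ-algebra of sets supported by `A`. -/
theorem ofReal_integral (μ : FSProb E X) {f : X → unitInterval} {A : Finset V}
    (hf : Invariant E A f) :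
    ENNReal.ofReal (μ.integral f) =
      @MeasureTheory.lintegral X (supportedSets E X A) (μ.toMeasure A)
        (fun x => ENNReal.ofReal (f x)) := by
  refine le_antisymm ?_ ?_
  · refine ENNReal.ofReal_le_of_le_toReal (Real.sSup_le ?_ ENNReal.toReal_nonneg)
    rintro t ⟨n, r, U, h, rfl⟩
    refine (ENNReal.ofReal_le_iff_le_toReal ?_).1 (μ.simple_le hf h)
    exact ((μ.lintegral_le_one f A).trans_lt ENNReal.one_lt_top).ne
  · let _ := supportedSets E X A
    rw [MeasureTheory.lintegral_def]
    refine iSup₂_le fun g hg => ?_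
    have hg1 : ∀ x, g x ≤ 1 := fun x => (hg x).trans (by simpa using unitInterval.le_one (f x))
    have hr : ∀ y ∈ g.range, y ≤ 1 := fun y hy => by
      obtain ⟨x, rfl⟩ := MeasureTheory.SimpleFunc.mem_range.1 hy; exact hg1 x
    let e := g.range.equivFin
    let r : Fin g.range.card → unitInterval := fun i =>
      ⟨((e.symm i : ENNReal)).toReal, ENNReal.toReal_nonneg,
        ENNReal.toReal_le_of_le_ofReal zero_le_one (by simpa using hr _ (e.symm i).2)⟩
    let U : Fin g.range.card → Event E X := fun i => ⟨g ⁻¹' {(e.symm i : ENNReal)}, A,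
      g.measurableSet_fiber _⟩
    have hlt : ∀ y ∈ g.range, ENNReal.ofReal y.toReal = y := fun y hy =>
      ENNReal.ofReal_toReal ((hr y hy).trans_lt ENNReal.one_lt_top).ne
    have hsum : g.lintegral (μ.toMeasure A) = ENNReal.ofReal (∑ i, (r i : ℝ) * μ (U i)) := by
      rw [ENNReal.ofReal_sum_of_nonneg
        fun i _ => mul_nonneg (unitInterval.nonneg _) (unitInterval.nonneg _),
        MeasureTheory.SimpleFunc.lintegral, ← Finset.sum_coe_sort, ← Equiv.sum_comp e.symm]
      refine Finset.sum_congr rfl fun i _ => ?_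
      rw [ENNReal.ofReal_mul (unitInterval.nonneg _), ← μ.toMeasure_apply (A := A) (S := U i) (g.measurableSet_fiber _)]
      change _ = ENNReal.ofReal ((e.symm i : ENNReal)).toReal * _
      rw [hlt _ (e.symm i).2]
    rw [hsum]
    refine ENNReal.ofReal_le_ofReal (le_csSup (μ.bddAbove_simple f) ⟨_, r, U, fun x => ?_, rfl⟩)
    have hx : g x ∈ g.range := g.mem_range_self x
    rw [Finset.sum_eq_single (e ⟨g x, hx⟩)]
    · rw [Set.indicator_of_mem (by simp [U])]
      refine (?_ : ((e.symm (e ⟨g x, hx⟩) : ENNReal)).toReal ≤ f x)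
      rw [Equiv.symm_apply_apply]
      exact ENNReal.toReal_le_of_le_ofReal (unitInterval.nonneg _) (hg x)
    · intro i _ hi
      refine Set.indicator_of_notMem (fun h => hi ?_) _
      have h' : g x = (e.symm i : ENNReal) := h
      rw [← Equiv.symm_apply_eq]
      exact Subtype.ext h'.symm
    · simp

theorem indicator_congr {Y : Type w} {S : Set X} {T : Set Y} {x : X} {y : Y} (h : x ∈ S ↔ y ∈ T)
    (c : ℝ) : S.indicator (fun _ => c) x = T.indicator (fun _ => c) y := by
  by_cases hx : x ∈ S
  · simp [hx, h.1 hx]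
  · simp [hx, mt h.2 hx]

theorem integral_smul (σ : E ≃g E) (μ : FSProb E X) (f : X → unitInterval) :
    (σ • μ).integral f = μ.integral (fun x => f (σ • x)) := by
  unfold integral
  congr 1
  ext t
  constructor
  · rintro ⟨n, r, U, h, rfl⟩
    refine ⟨n, r, fun i => σ⁻¹ • U i, fun x => ?_, rfl⟩
    refine (Finset.sum_le_sum fun i _ => le_of_eq ?_).trans (h (σ • x))
    exact indicator_congr Set.mem_inv_smul_set_iff _
  · rintro ⟨n, r, U, h, rfl⟩
    refine ⟨n, r, fun i => σ • U i, fun x => ?_, by simp [smul_apply]⟩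
    have := h (σ⁻¹ • x)
    simp only [smul_inv_smul] at this
    refine (Finset.sum_le_sum fun i _ => le_of_eq ?_).trans this
    exact indicator_congr Set.mem_smul_set_iff_inv_smul_mem _

/-- The Dirac measure, `δₓ(S) = [x ∈ S]`. -/
noncomputable def dirac (x : X) (hx : FinSupp E x) : FSProb E X where
  toFun S := ⟨S.1.indicator (fun _ => (1 : ℝ)) x,
    Set.indicator_nonneg (fun _ _ => zero_le_one) _,
    Set.indicator_le_self' (fun _ _ => zero_le_one) _⟩
  finSupp' := by
    obtain ⟨A, hA⟩ := hx
    refine ⟨A, fun σ hσ S => Subtype.ext ?_⟩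
    refine indicator_congr ?_ _
    rw [Event.coe_smul, Set.mem_smul_set_iff_inv_smul_mem, hA _ hσ.inv]
  additive' := by
    intro S U _ hd hU
    change HasSum (fun i => (S i).1.indicator (fun _ => (1 : ℝ)) x) (U.1.indicator (fun _ => (1 : ℝ)) x)
    rw [hU]
    by_cases hx : ∃ i, x ∈ (S i).1
    · obtain ⟨i, hi⟩ := hx
      rw [Set.indicator_of_mem (Set.mem_iUnion.2 ⟨i, hi⟩)]
      have := hasSum_single (f := fun i => (S i).1.indicator (fun _ => (1 : ℝ)) x) i
        fun j hj => Set.indicator_of_notMem (fun h => (hd hj).le_bot ⟨h, hi⟩) _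
      simpa only [Set.indicator_of_mem hi] using this
    · push Not at hx
      have h0 : ∀ i, (S i).1.indicator (fun _ => (1 : ℝ)) x = 0 := fun i =>
        Set.indicator_of_notMem (hx i) _
      simp only [h0]
      rw [Set.indicator_of_notMem (by simpa using hx)]
      exact hasSum_zero
  total' := Subtype.ext (Set.indicator_of_mem (s := Set.univ) (Set.mem_univ x) fun _ => (1 : ℝ))

theorem dirac_apply (x : X) (hx : FinSupp E x) (S : Event E X) :
    (dirac x hx S : ℝ) = S.1.indicator (fun _ => (1 : ℝ)) x := rfl

theorem smul_dirac (σ : E ≃g E) (x : X) (hx : FinSupp E x) (hx' : FinSupp E (σ • x)) :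
    σ • dirac x hx = dirac (σ • x) hx' := by
  ext S
  exact indicator_congr Set.mem_inv_smul_set_iff _

/-- The convex combination `r · μ + (1 - r) · ν`. -/
noncomputable def mix (r : unitInterval) (μ ν : FSProb E X) : FSProb E X where
  toFun S := ⟨r * μ S + (1 - r) * ν S, by
    have := r.2.1; have := r.2.2; have := (μ S).2.1; have := (ν S).2.1
    constructor
    · nlinarith
    · nlinarith [mul_nonneg r.2.1 (sub_nonneg.2 (μ S).2.2),
        mul_nonneg (sub_nonneg.2 r.2.2) (sub_nonneg.2 (ν S).2.2)]⟩
  finSupp' := by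
    classical
    obtain ⟨A, hA⟩ := μ.finSupp'
    obtain ⟨B, hB⟩ := ν.finSupp'
    refine ⟨A ∪ B, fun σ hσ S => ?_⟩
    simp only [hA σ (hσ.mono Finset.subset_union_left), hB σ (hσ.mono Finset.subset_union_right)]
  additive' S U hA hd hU :=
    ((μ.additive' S U hA hd hU).mul_left _).add ((ν.additive' S U hA hd hU).mul_left _)
  total' := Subtype.ext (by simp [μ.total', ν.total'])

theorem smul_mix (σ : E ≃g E) (r : unitInterval) (μ ν : FSProb E X) :
    σ • mix r μ ν = mix r (σ • μ) (σ • ν) := rfl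

variable {Y : Type w} [MulAction (E ≃g E) Y]

theorem invariant_kernel {k : X → FSProb E Y} {A : Finset V} (hk : SupportsFun E A k)
    {S : Event E Y} (hS : Supports E A S.1) : Invariant E A (fun x => k x S) := fun σ hσ x => by
  change k (σ • x) S = k x S
  rw [hk σ hσ, smul_apply]
  exact congrArg _ (Subtype.ext (hS _ hσ.inv))

theorem measurable_kernel {k : X → FSProb E Y} {A : Finset V} (hk : SupportsFun E A k) :
    @Measurable X _ (supportedSets E X A)
      (@MeasureTheory.Measure.instMeasurableSpace Y (supportedSets E Y A))
      (fun x => (k x).toMeasure A) := by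
  let _ := supportedSets E X A
  let _ := supportedSets E Y A
  refine MeasureTheory.Measure.measurable_of_measurable_coe _ fun S hS => ?_
  have h : ∀ x, (k x).toMeasure A S = ENNReal.ofReal (k x ⟨S, A, hS⟩) := fun x =>
    (k x).toMeasure_apply (S := ⟨S, A, hS⟩) hS
  simp_rw [h]
  exact (ENNReal.measurable_ofReal.comp measurable_subtype_coe).comp
    (invariant_kernel hk (S := ⟨S, A, hS⟩) hS).measurable

theorem ofReal_integral_kernel (μ : FSProb E X) {k : X → FSProb E Y} {A : Finset V}
    (hk : SupportsFun E A k) {S : Event E Y} (hS : Supports E A S.1) :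
    ENNReal.ofReal (μ.integral fun x => k x S) =
      @MeasureTheory.Measure.bind X Y (supportedSets E X A) (supportedSets E Y A)
        (μ.toMeasure A) (fun x => (k x).toMeasure A) S.1 := by
  let _ := supportedSets E X A
  let _ := supportedSets E Y A
  rw [MeasureTheory.Measure.bind_apply (show MeasurableSet S.1 from hS)
    (measurable_kernel hk).aemeasurable, μ.ofReal_integral (invariant_kernel hk hS)]
  simp_rw [(k _).toMeasure_apply hS]

/-- The bind of the probability monad, `(μ >>= k)(S) = ∫ k(x, S) μ(dx)`, for a finitely supported
kernel `k`. -/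
noncomputable def bind (μ : FSProb E X) (k : X → FSProb E Y) (hk : ∃ A, SupportsFun E A k) :
    FSProb E Y where
  toFun S := ⟨μ.integral fun x => k x S, μ.integral_nonneg _, μ.integral_le_one _⟩
  finSupp' := by
    classical
    obtain ⟨A, hA⟩ := hk
    obtain ⟨B, hB⟩ := μ.finSupp
    refine ⟨A ∪ B, fun σ hσ S => Subtype.ext ?_⟩
    change μ.integral (fun x => k x (σ • S)) = μ.integral (fun x => k x S)
    conv_lhs => rw [← hB σ (hσ.mono Finset.subset_union_right)]
    rw [integral_smul]
    congr 1
    ext x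
    rw [hA σ (hσ.mono Finset.subset_union_left), smul_apply, inv_smul_smul]
  additive' := by
    classical
    rintro S U ⟨B, hB⟩ hd hU
    obtain ⟨A', hA'⟩ := hk
    obtain ⟨A, hA, hSA⟩ : ∃ A, SupportsFun E A k ∧ ∀ i, Supports E A (S i).1 :=
      ⟨A' ∪ B, fun σ hσ => hA' σ (hσ.mono Finset.subset_union_left),
        fun i => (hB i).mono Finset.subset_union_right⟩
    let _ := supportedSets E X A
    let _ := supportedSets E Y A
    have hUA : Supports E A U.1 := hU ▸ (supportedSets E Y A).measurableSet_iUnion _ hSA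
    have key := MeasureTheory.measure_iUnion
      (μ := MeasureTheory.Measure.bind (μ.toMeasure A) (fun x => (k x).toMeasure A)) hd hSA
    rw [← hU, ← ofReal_integral_kernel μ hA hUA] at key
    simp_rw [← ofReal_integral_kernel μ hA (hSA _)] at key
    have h2 := ENNReal.hasSum_toReal (key ▸ ENNReal.ofReal_ne_top)
    rw [← ENNReal.tsum_toReal_eq fun _ => ENNReal.ofReal_ne_top, ← key] at h2
    simpa only [ENNReal.toReal_ofReal (integral_nonneg _ _)] using h2
  total' := Subtype.ext (by
    have hk' := hk
    obtain ⟨A, hA⟩ := hk'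
    have hu : Supports E A (Event.univ E Y).1 := supports_set_of fun _ _ _ _ => trivial
    have h := μ.ofReal_integral (invariant_kernel hA hu)
    simp only [total', Set.Icc.coe_one, ENNReal.ofReal_one, MeasureTheory.lintegral_const,
      toMeasure_univ, mul_one] at h
    change (μ.integral fun x => k x (Event.univ E Y)) = 1
    simp only [total']
    rwa [ENNReal.ofReal_eq_one] at h)

theorem bind_apply (μ : FSProb E X) (k : X → FSProb E Y) (hk : ∃ A, SupportsFun E A k)
    (S : Event E Y) : (μ.bind k hk S : ℝ) = μ.integral fun x => k x S := rfl

theorem toMeasure_bind (μ : FSProb E X) {k : X → FSProb E Y} {A : Finset V}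
    (hk : SupportsFun E A k) :
    (μ.bind k ⟨A, hk⟩).toMeasure A =
      @MeasureTheory.Measure.bind X Y (supportedSets E X A) (supportedSets E Y A)
        (μ.toMeasure A) (fun x => (k x).toMeasure A) := by
  refine @MeasureTheory.Measure.ext Y (supportedSets E Y A) _ _ fun S hS => ?_
  rw [← ofReal_integral_kernel μ hk (S := ⟨S, A, hS⟩) hS]
  exact toMeasure_apply _ (S := ⟨S, A, hS⟩) hS

theorem bind_congr {μ : FSProb E X} {k k' : X → FSProb E Y} (h : ∀ x, k x = k' x)
    (hk : ∃ A, SupportsFun E A k) (hk' : ∃ A, SupportsFun E A k') : μ.bind k hk = μ.bind k' hk' := by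
  obtain rfl : k = k' := funext h
  rfl

theorem smul_bind (σ : E ≃g E) (μ : FSProb E X) (k k' : X → FSProb E Y)
    (hk : ∃ A, SupportsFun E A k) (hk' : ∃ A, SupportsFun E A k')
    (h : ∀ x, k' (σ • x) = σ • k x) : (σ • μ).bind k' hk' = σ • μ.bind k hk := by
  ext S
  rw [smul_apply, bind_apply, bind_apply, integral_smul]
  simp_rw [h, smul_apply]

theorem integral_bind (μ : FSProb E X) (k : X → FSProb E Y) (hk : ∃ A, SupportsFun E A k)
    {f : Y → unitInterval} (hf : ∃ A, Invariant E A f) :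
    (μ.bind k hk).integral f =
      μ.integral fun x => ⟨(k x).integral f, integral_nonneg _ _, integral_le_one _ _⟩ := by
  classical
  obtain ⟨A', hA'⟩ := hk
  obtain ⟨B, hB⟩ := hf
  obtain ⟨A, hA, hfA⟩ : ∃ A, SupportsFun E A k ∧ Invariant E A f :=
    ⟨A' ∪ B, fun σ hσ => hA' σ (hσ.mono Finset.subset_union_left),
      fun σ hσ => hB σ (hσ.mono Finset.subset_union_right)⟩
  let _ := supportedSets E X A
  let _ := supportedSets E Y A
  have hm : Measurable fun y => ENNReal.ofReal (f y) :=
    (ENNReal.measurable_ofReal.comp measurable_subtype_coe).comp hfA.measurable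
  have hi : Invariant E A fun x =>
      (⟨(k x).integral f, integral_nonneg _ _, integral_le_one _ _⟩ : unitInterval) := by
    intro σ hσ x
    refine Subtype.ext ?_
    change (k (σ • x)).integral f = (k x).integral f
    rw [hA σ hσ, integral_smul]
    simp_rw [hfA σ hσ]
  rw [← ENNReal.ofReal_eq_ofReal_iff (integral_nonneg _ _) (integral_nonneg _ _),
    ofReal_integral _ hfA, ofReal_integral _ hi, toMeasure_bind μ hA,
    MeasureTheory.Measure.lintegral_bind (measurable_kernel hA).aemeasurable hm.aemeasurable]
  simp_rw [ofReal_integral _ hfA]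

theorem integral_dirac (x : X) (hx : FinSupp E x) {f : X → unitInterval}
    (hf : ∃ A, Invariant E A f) : (dirac x hx).integral f = f x := by
  obtain ⟨A, hA⟩ := hf
  let _ := supportedSets E X A
  have h : (dirac x hx).toMeasure A = MeasureTheory.Measure.dirac x := by
    refine MeasureTheory.Measure.ext fun S hS => ?_
    rw [MeasureTheory.Measure.dirac_apply' _ hS]
    refine (toMeasure_apply _ (S := ⟨S, A, hS⟩) hS).trans ?_
    refine (congrArg ENNReal.ofReal (dirac_apply x hx ⟨S, A, hS⟩)).trans ?_
    by_cases h : x ∈ S <;> simp [h]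
  have hm : Measurable fun y => ENNReal.ofReal (f y) :=
    (ENNReal.measurable_ofReal.comp measurable_subtype_coe).comp hA.measurable
  rw [← ENNReal.ofReal_eq_ofReal_iff (integral_nonneg _ _) (unitInterval.nonneg _),
    ofReal_integral _ hA, h, MeasureTheory.lintegral_dirac' _ hm]

theorem dirac_bind (x : X) (hx : FinSupp E x) (k : X → FSProb E Y)
    (hk : ∃ A, SupportsFun E A k) : (dirac x hx).bind k hk = k x := by
  classical
  ext S
  rw [bind_apply, integral_dirac]
  obtain ⟨A, hA⟩ := hk
  obtain ⟨B, hB⟩ := S.2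
  exact ⟨A ∪ B, invariant_kernel (fun σ hσ => hA σ (hσ.mono Finset.subset_union_left))
    (hB.mono Finset.subset_union_right)⟩

theorem bind_dirac (μ : FSProb E X) (h : ∀ x : X, FinSupp E x)
    (hk : ∃ A, SupportsFun E A fun x => dirac x (h x)) : μ.bind (fun x => dirac x (h x)) hk = μ := by
  ext S
  obtain ⟨A, hA⟩ := S.2
  let _ := supportedSets E X A
  have hk' : SupportsFun E A fun x => dirac x (h x) := fun σ _ x => (smul_dirac σ x _ _).symm
  rw [bind_apply, ← ENNReal.ofReal_eq_ofReal_iff (integral_nonneg _ _) (unitInterval.nonneg _),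
    ofReal_integral _ (invariant_kernel hk' hA), ← toMeasure_apply μ hA,
    ← MeasureTheory.lintegral_indicator_one (show MeasurableSet S.1 from hA)]
  refine MeasureTheory.lintegral_congr fun x => ?_
  rw [dirac_apply]
  by_cases hx : x ∈ S.1 <;> simp [hx]

theorem exists_supportsFun_bind {Z : Type*} [MulAction (E ≃g E) Z] {k : X → FSProb E Y}
    (hk : ∃ A, SupportsFun E A k) {h : Y → FSProb E Z} (hh : ∃ A, SupportsFun E A h) :
    ∃ A, SupportsFun E A fun x => (k x).bind h hh := by
  classical
  have hh' := hh
  obtain ⟨A, hA⟩ := hk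
  obtain ⟨B, hB⟩ := hh'
  refine ⟨A ∪ B, fun σ hσ x => ?_⟩
  change (k (σ • x)).bind h hh = _
  rw [hA σ (hσ.mono Finset.subset_union_left)]
  exact smul_bind σ (k x) h h hh hh (hB σ (hσ.mono Finset.subset_union_right))

theorem bind_assoc {Z : Type*} [MulAction (E ≃g E) Z] (μ : FSProb E X) (k : X → FSProb E Y)
    (hk : ∃ A, SupportsFun E A k) (h : Y → FSProb E Z) (hh : ∃ A, SupportsFun E A h) :
    (μ.bind k hk).bind h hh =
      μ.bind (fun x => (k x).bind h hh) (exists_supportsFun_bind hk hh) := by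
  classical
  ext S
  rw [bind_apply, integral_bind]
  · rfl
  obtain ⟨A, hA⟩ := hh
  obtain ⟨B, hB⟩ := S.2
  exact ⟨A ∪ B, invariant_kernel (fun σ hσ => hA σ (hσ.mono Finset.subset_union_left))
    (hB.mono Finset.subset_union_right)⟩

end FSProb

end Measures

section Category

variable {V : Type u}

/-- A nominal set over the graph `E`: a set with an action of the automorphisms of `E`, all of whose
elements have finite support. When `E` is the Rado graph, these are the Rado-nominal sets. -/
structure RadoNom (E : SimpleGraph V) where
  carrier : Type u
  action : MulAction (E ≃g E) carrier
  finSupp : ∀ x : carrier, FinSupp E x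

namespace RadoNom

variable {E : SimpleGraph V}

instance : CoeSort (RadoNom E) (Type u) := ⟨carrier⟩

instance (X : RadoNom E) : MulAction (E ≃g E) X := X.action

/-- Equivariant functions. -/
@[ext]
structure Hom (X Y : RadoNom E) where
  toFun : X → Y
  map_smul : ∀ (σ : E ≃g E) (x : X), toFun (σ • x) = σ • toFun x

instance : Category (RadoNom E) where
  Hom := Hom
  id X := ⟨id, fun _ _ => rfl⟩
  comp f g := ⟨fun x => g.toFun (f.toFun x), fun σ x => by rw [f.map_smul, g.map_smul]⟩

instance {X Y : RadoNom E} : CoeFun (X ⟶ Y) fun _ => X → Y := ⟨Hom.toFun⟩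

theorem hom_ext {X Y : RadoNom E} {f g : X ⟶ Y} (h : ∀ x, f x = g x) : f = g :=
  Hom.ext (funext h)

theorem map_smul {X Y : RadoNom E} (f : X ⟶ Y) (σ : E ≃g E) (x : X) : f (σ • x) = σ • f x :=
  Hom.map_smul f σ x

theorem comp_apply {X Y Z : RadoNom E} (f : X ⟶ Y) (g : Y ⟶ Z) (x : X) : (f ≫ g) x = g (f x) := rfl

theorem id_apply {X : RadoNom E} (x : X) : (𝟙 X : X ⟶ X) x = x := rfl

/-- A set with the discrete (trivial) action. -/
def discrete (E : SimpleGraph V) (S : Type u) : RadoNom E where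
  carrier := S
  action := { smul := fun _ s => s, one_smul := fun _ => rfl, mul_smul := fun _ _ _ => rfl }
  finSupp _ := ⟨∅, fun _ _ => rfl⟩

/-- The binary product, with the coordinatewise action. -/
def prod (X Y : RadoNom E) : RadoNom E where
  carrier := X × Y
  action := inferInstance
  finSupp := by
    classical
    rintro ⟨x, y⟩
    obtain ⟨A, hA⟩ := X.finSupp x
    obtain ⟨B, hB⟩ := Y.finSupp y
    exact ⟨A ∪ B, fun σ hσ => Prod.ext (hA σ (hσ.mono Finset.subset_union_left))
      (hB σ (hσ.mono Finset.subset_union_right))⟩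

/-- The finite products of nominal sets: the one-point set, and the products of sets with the
coordinatewise action. -/
noncomputable instance : CartesianMonoidalCategory (RadoNom E) :=
  CartesianMonoidalCategory.ofChosenFiniteProducts
    ⟨_, Limits.IsTerminal.ofUniqueHom (Y := discrete E PUnit)
      (fun _ => (⟨fun _ => PUnit.unit, fun _ _ => rfl⟩ : Hom _ _))
      (fun _ _ => hom_ext fun _ => rfl)⟩
    (fun X Y => ⟨Limits.BinaryFan.mk (P := prod X Y)
        (⟨Prod.fst, fun _ _ => rfl⟩ : Hom _ _) (⟨Prod.snd, fun _ _ => rfl⟩ : Hom _ _),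
      Limits.BinaryFan.isLimitMk
        (fun s => (⟨fun z => (s.fst z, s.snd z), fun σ z =>
          Prod.ext (map_smul s.fst σ z) (map_smul s.snd σ z)⟩ : Hom _ _))
        (fun _ => rfl) (fun _ => rfl)
        (fun _ _ h1 h2 => hom_ext fun z => Prod.ext
          (congrArg (fun f => Hom.toFun f z) h1) (congrArg (fun f => Hom.toFun f z) h2))⟩)

/-- The point of a product of nominal sets with given coordinates. -/
def pair {X Y : RadoNom E} (x : X) (y : Y) : (X ⊗ Y : RadoNom E) := (x, y)

theorem smul_pair {X Y : RadoNom E} (σ : E ≃g E) (x : X) (y : Y) :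
    σ • pair x y = pair (σ • x) (σ • y) := rfl

theorem fst_pair {X Y : RadoNom E} (x : X) (y : Y) : fst X Y (pair x y) = x := rfl

theorem snd_pair {X Y : RadoNom E} (x : X) (y : Y) : snd X Y (pair x y) = y := rfl

theorem lift_apply {X Y Z : RadoNom E} (f : Z ⟶ X) (g : Z ⟶ Y) (z : Z) :
    lift f g z = pair (f z) (g z) := rfl

theorem whiskerRight_apply {X Y Z : RadoNom E} (f : X ⟶ Y) (x : X) (z : Z) :
    (f ▷ Z) (pair x z) = pair (f x) z := rfl

end RadoNom

open RadoNom

variable (E : SimpleGraph V)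

/-- The nominal set of finitely supported probability measures on `X`. -/
abbrev probObj (X : RadoNom E) : RadoNom E := ⟨FSProb E X, inferInstance, FSProb.finSupp⟩

variable {E}

theorem supportsFun_curry {Z X Y : RadoNom E} (g : Z ⊗ X ⟶ Y) (z : Z) :
    ∃ A, SupportsFun E A fun x => g (pair z x) := by
  obtain ⟨A, hA⟩ := Z.finSupp z
  refine ⟨A, fun σ hσ x => ?_⟩
  rw [← map_smul, smul_pair, hA σ hσ]

variable (E)

/-- The nominal probability monad: Dirac measures as unit, integration of kernels as bind. -/
noncomputable def probMonad : StrongMonad (RadoNom E) where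
  obj X := probObj E X
  η X := (⟨fun x => FSProb.dirac x (X.finSupp x),
    fun σ x => (FSProb.smul_dirac σ x _ _).symm⟩ : Hom X (probObj E X))
  bind {Z X Y} f g := (⟨fun z => FSProb.bind (f z) (fun x => g (pair z x)) (supportsFun_curry g z),
    fun σ z => by
      refine (FSProb.bind_congr (μ := f (σ • z)) (fun _ => rfl) _ _).trans
        (?_ : FSProb.bind (f (σ • z)) _ (supportsFun_curry g (σ • z)) = _)
      rw [map_smul f]
      exact FSProb.smul_bind σ (f z) _ _ _ _ fun x => map_smul g σ (pair z x)⟩ :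
      Hom Z (probObj E Y))
  bind_natural h f g := rfl
  η_bind f g := hom_ext fun z =>
    FSProb.dirac_bind (f z) (RadoNom.finSupp _ _) (fun x => g (pair z x)) (supportsFun_curry g z)
  bind_η {Z X} f := hom_ext fun z =>
    FSProb.bind_dirac (f z) X.finSupp
      ⟨∅, fun σ _ x => (FSProb.smul_dirac σ x _ _).symm⟩
  bind_assoc f g h := hom_ext fun z =>
    FSProb.bind_assoc (f z) (fun x => g (pair z x)) (supportsFun_curry g z)
      (fun y => h (pair z y)) (supportsFun_curry h z)

end Category

section RadoGraph

variable {V : Type u}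

/-- `(V, E)` is the Rado graph: a countably infinite graph with the extension property. -/
structure IsRado (E : SimpleGraph V) : Prop where
  countable : Countable V
  infinite : Infinite V
  extension : ∀ A B : Finset V, Disjoint A B →
    ∃ v, v ∉ A ∧ v ∉ B ∧ (∀ a ∈ A, E.Adj v a) ∧ ∀ b ∈ B, ¬ E.Adj v b

variable {E : SimpleGraph V}

/-- Finite partial isomorphisms of `E`. -/
def PartialAut (E : SimpleGraph V) : Type u :=
  {f : Finset (V × V) // ∀ p ∈ f, ∀ q ∈ f,
    (p.1 = q.1 ↔ p.2 = q.2) ∧ (E.Adj p.1 q.1 ↔ E.Adj p.2 q.2)}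

instance : Preorder (PartialAut E) := Preorder.lift Subtype.val

theorem IsRado.exists_forth (hE : IsRado E) (f : PartialAut E) (a : V) :
    ∃ g : PartialAut E, (∃ b, (a, b) ∈ g.1) ∧ f.1 ⊆ g.1 := by
  classical
  by_cases h : ∃ b, (a, b) ∈ f.1
  · exact ⟨f, h, subset_rfl⟩
  have ha : ∀ p ∈ f.1, p.1 ≠ a := fun p hp hpa => h ⟨p.2, by rwa [← hpa]⟩
  obtain ⟨b, hbA, hbB, hA, hB⟩ := hE.extension
    ((f.1.filter fun p => E.Adj a p.1).image Prod.snd)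
    ((f.1.filter fun p => ¬ E.Adj a p.1).image Prod.snd) (by
      rw [Finset.disjoint_left]
      intro x hx hy
      obtain ⟨p, hp, rfl⟩ := Finset.mem_image.1 hx
      obtain ⟨q, hq, hpq⟩ := Finset.mem_image.1 hy
      rw [Finset.mem_filter] at hp hq
      have := (f.2 q hq.1 p hp.1).1.2 hpq
      exact hq.2 (this ▸ hp.2))
  have hadj : ∀ p ∈ f.1, (E.Adj a p.1 ↔ E.Adj b p.2) := fun p hp => by
    by_cases hap : E.Adj a p.1
    · exact iff_of_true hap (hA _ (Finset.mem_image.2 ⟨p, Finset.mem_filter.2 ⟨hp, hap⟩, rfl⟩))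
    · exact iff_of_false hap (hB _ (Finset.mem_image.2 ⟨p, Finset.mem_filter.2 ⟨hp, hap⟩, rfl⟩))
  have hne : ∀ p ∈ f.1, p.2 ≠ b := fun p hp hpb => by
    by_cases hap : E.Adj a p.1
    · exact hbA (hpb ▸ Finset.mem_image.2 ⟨p, Finset.mem_filter.2 ⟨hp, hap⟩, rfl⟩)
    · exact hbB (hpb ▸ Finset.mem_image.2 ⟨p, Finset.mem_filter.2 ⟨hp, hap⟩, rfl⟩)
  refine ⟨⟨insert (a, b) f.1, fun p hp q hq => ?_⟩, ⟨b, Finset.mem_insert_self _ _⟩,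
    Finset.subset_insert _ _⟩
  rcases Finset.mem_insert.1 hp with rfl | hp <;> rcases Finset.mem_insert.1 hq with rfl | hq
  · simp
  · exact ⟨iff_of_false (ha q hq).symm (hne q hq).symm, hadj q hq⟩
  · exact ⟨iff_of_false (ha p hp) (hne p hp), by
      rw [E.adj_comm, hadj p hp, E.adj_comm]⟩
  · exact f.2 p hp q hq

/-- The inverse of a partial isomorphism. -/
def PartialAut.inv [DecidableEq V] (f : PartialAut E) : PartialAut E :=
  ⟨f.1.image Prod.swap, fun p hp q hq => by
    obtain ⟨p, hp', rfl⟩ := Finset.mem_image.1 hp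
    obtain ⟨q, hq', rfl⟩ := Finset.mem_image.1 hq
    exact ⟨(f.2 p hp' q hq').1.symm, (f.2 p hp' q hq').2.symm⟩⟩

theorem IsRado.exists_back (hE : IsRado E) (f : PartialAut E) (b : V) :
    ∃ g : PartialAut E, (∃ a, (a, b) ∈ g.1) ∧ f.1 ⊆ g.1 := by
  classical
  obtain ⟨g, ⟨a, ha⟩, hg⟩ := hE.exists_forth f.inv b
  refine ⟨g.inv, ⟨a, Finset.mem_image.2 ⟨_, ha, rfl⟩⟩, fun p hp => ?_⟩
  exact Finset.mem_image.2 ⟨p.swap, hg (Finset.mem_image_of_mem _ hp), p.swap_swap⟩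

/-- Every finite partial isomorphism of the Rado graph extends to an automorphism. -/
theorem IsRado.exists_extend (hE : IsRado E) (f : PartialAut E) :
    ∃ σ : E ≃g E, ∀ p ∈ f.1, σ p.1 = p.2 := by
  have := hE.countable
  cases nonempty_encodable V
  let D : V ⊕ V → Order.Cofinal (PartialAut E) := Sum.elim
    (fun a => ⟨{g | ∃ b, (a, b) ∈ g.1}, fun f => hE.exists_forth f a⟩)
    (fun b => ⟨{g | ∃ a, (a, b) ∈ g.1}, fun f => hE.exists_back f b⟩)
  let I := Order.idealOfCofinals f D
  have hF : ∀ a, ∃ b, ∃ g ∈ I, (a, b) ∈ g.1 := fun a => by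
    obtain ⟨g, ⟨b, hb⟩, hg⟩ := Order.cofinal_meets_idealOfCofinals f D (Sum.inl a)
    exact ⟨b, g, hg, hb⟩
  have hG : ∀ b, ∃ a, ∃ g ∈ I, (a, b) ∈ g.1 := fun b => by
    obtain ⟨g, ⟨a, ha⟩, hg⟩ := Order.cofinal_meets_idealOfCofinals f D (Sum.inr b)
    exact ⟨a, g, hg, ha⟩
  have key : ∀ p q : V × V, (∃ g ∈ I, p ∈ g.1) → (∃ g ∈ I, q ∈ g.1) →
      (p.1 = q.1 ↔ p.2 = q.2) ∧ (E.Adj p.1 q.1 ↔ E.Adj p.2 q.2) := by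
    rintro p q ⟨g, hg, hp⟩ ⟨g', hg', hq⟩
    obtain ⟨m, _, h1, h2⟩ := I.directed _ hg _ hg'
    exact m.2 p (h1 hp) q (h2 hq)
  choose F hF using hF
  choose G hG using hG
  refine ⟨⟨⟨F, G, fun a => ?_, fun b => ?_⟩, fun {a b} => ?_⟩, fun p hp => ?_⟩
  · exact (key (G (F a), F a) (a, F a) (hG _) (hF a)).1.2 rfl
  · exact (key (G b, F (G b)) (G b, b) (hF _) (hG b)).1.1 rfl
  · exact (key (a, F a) (b, F b) (hF a) (hF b)).2.symm
  · exact (key (p.1, F p.1) p (hF _) ⟨f, Order.mem_idealOfCofinals f D, hp⟩).1.1 rfl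

/-- Vertices outside `A` with the same edges to `A` are in the same orbit over `A`. -/
theorem IsRado.exists_fixing (hE : IsRado E) {A : Finset V} {v w : V} (hv : v ∉ A) (hw : w ∉ A)
    (h : ∀ a ∈ A, E.Adj v a ↔ E.Adj w a) : ∃ σ : E ≃g E, Fixes σ A ∧ σ v = w := by
  classical
  obtain ⟨σ, hσ⟩ := hE.exists_extend
    ⟨insert (v, w) (A.image fun a => (a, a)), fun p hp q hq => by
      rcases Finset.mem_insert.1 hp with rfl | hp <;> rcases Finset.mem_insert.1 hq with rfl | hq
      · simp
      · obtain ⟨a, ha, rfl⟩ := Finset.mem_image.1 hq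
        have h1 : v ≠ a := fun e => hv (e ▸ ha)
        have h2 : w ≠ a := fun e => hw (e ▸ ha)
        exact ⟨iff_of_false h1 h2, h a ha⟩
      · obtain ⟨a, ha, rfl⟩ := Finset.mem_image.1 hp
        have h1 : a ≠ v := fun e => hv (e ▸ ha)
        have h2 : a ≠ w := fun e => hw (e ▸ ha)
        refine ⟨iff_of_false h1 h2, ?_⟩
        rw [E.adj_comm, h a ha, E.adj_comm]
      · obtain ⟨a, ha, rfl⟩ := Finset.mem_image.1 hp
        obtain ⟨b, hb, rfl⟩ := Finset.mem_image.1 hq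
        exact ⟨Iff.rfl, Iff.rfl⟩⟩
  exact ⟨σ, fun a ha => hσ (a, a) (Finset.mem_insert_of_mem (Finset.mem_image_of_mem _ ha)),
    hσ (v, w) (Finset.mem_insert_self _ _)⟩

theorem IsRado.mem_iff (hE : IsRado E) {A : Finset V} {S : Set V} (hS : Supports E A S) {v w : V}
    (hv : v ∉ A) (hw : w ∉ A) (h : ∀ a ∈ A, E.Adj v a ↔ E.Adj w a) : v ∈ S ↔ w ∈ S := by
  obtain ⟨σ, hσ, rfl⟩ := hE.exists_fixing hv hw h
  exact (hS.mem_iff hσ v).symm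

/-- `v` enumerates vertices outside `A` that realize all the possible edge relationships with the
elements of `A`: the vertex `v B` is adjacent to exactly those elements of `A` that are in `B`,
where `B` ranges over the subsets of `A`. -/
def IsEnumeration (E : SimpleGraph V) (A : Finset V) (v : Finset V → V) : Prop :=
  ∀ B ⊆ A, v B ∉ A ∧ ∀ a ∈ A, E.Adj (v B) a ↔ a ∈ B

theorem IsRado.exists_enumeration (hE : IsRado E) (A : Finset V) :
    ∃ v, IsEnumeration E A v := by
  classical
  have : ∀ B : Finset V, ∃ w, B ⊆ A → w ∉ A ∧ ∀ a ∈ A, E.Adj w a ↔ a ∈ B := fun B => by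
    obtain ⟨w, h1, h2, h3, h4⟩ := hE.extension B (A \ B) Finset.disjoint_sdiff
    refine ⟨w, fun hB => ⟨fun hw => ?_, fun a ha => ⟨fun h => ?_, h3 a⟩⟩⟩
    · exact h2 (Finset.mem_sdiff.2 ⟨hw, h1⟩)
    · by_contra haB
      exact h4 a (Finset.mem_sdiff.2 ⟨ha, haB⟩) h
  choose v hv using this
  exact ⟨v, hv⟩

open Classical in
/-- The sum `∑ⱼ [vⱼ ∈ S] ∏ᵢ (α E(vⱼ,aᵢ) + (1-α) (1 - E(vⱼ,aᵢ)))`, for an enumeration `v` of all the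
edge relationships with `A = {a₁,…,aₙ}`. -/
noncomputable def edgeSum (E : SimpleGraph V) (α : unitInterval) (A : Finset V) (v : Finset V → V)
    (S : Set V) : ℝ :=
  ∑ B ∈ A.powerset, S.indicator (fun _ => (1 : ℝ)) (v B) *
    ∏ a ∈ A, if E.Adj (v B) a then (α : ℝ) else 1 - α

theorem edgeSum_nonneg (α : unitInterval) (A : Finset V) (v : Finset V → V)
    (S : Set V) : 0 ≤ edgeSum E α A v S :=
  Finset.sum_nonneg fun _ _ => mul_nonneg (Set.indicator_nonneg (fun _ _ => zero_le_one) _)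
    (Finset.prod_nonneg fun _ _ => by split_ifs; exacts [α.2.1, sub_nonneg.2 α.2.2])

theorem edgeSum_mono (α : unitInterval) (A : Finset V) (v : Finset V → V)
    (S : Set V) : edgeSum E α A v S ≤ edgeSum E α A v Set.univ :=
  Finset.sum_le_sum fun _ _ => mul_le_mul_of_nonneg_right
    (Set.indicator_le_indicator_of_subset (Set.subset_univ S) (fun _ => zero_le_one) _)
    (Finset.prod_nonneg fun _ _ => by split_ifs; exacts [α.2.1, sub_nonneg.2 α.2.2])

theorem IsRado.edgeSum_insert [DecidableEq V] (hE : IsRado E) (α : unitInterval) {A : Finset V}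
    {S : Set V} (hS : Supports E A S) {a : V} (ha : a ∉ A) {v w : Finset V → V}
    (hv : IsEnumeration E A v) (hw : IsEnumeration E (insert a A) w) :
    edgeSum E α (insert a A) w S = edgeSum E α A v S := by
  classical
  unfold edgeSum
  have hs : A ⊆ insert a A := Finset.subset_insert a A
  rw [Finset.sum_powerset_insert ha, ← Finset.sum_add_distrib]
  refine Finset.sum_congr rfl fun B hB => ?_
  rw [Finset.mem_powerset] at hB
  have haB : a ∉ B := fun h => ha (hB h)
  obtain ⟨v1, v2⟩ := hv B hB
  obtain ⟨w1, w2⟩ := hw B (hB.trans hs)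
  obtain ⟨w3, w4⟩ := hw (insert a B) (Finset.insert_subset_insert a hB)
  have h2 : ∀ c ∈ A, (E.Adj (w B) c ↔ E.Adj (v B) c) := fun c hc => by
    rw [w2 c (hs hc), v2 c hc]
  have h4 : ∀ c ∈ A, (E.Adj (w (insert a B)) c ↔ E.Adj (v B) c) := fun c hc => by
    rw [w4 c (hs hc), v2 c hc, Finset.mem_insert, or_iff_right fun h : c = a => ha (h ▸ hc)]
  rw [FSProb.indicator_congr (hE.mem_iff hS (fun h => w1 (hs h)) v1 h2) 1,
    FSProb.indicator_congr (hE.mem_iff hS (fun h => w3 (hs h)) v1 h4) 1,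
    Finset.prod_insert ha, Finset.prod_insert ha,
    if_neg (fun h => haB ((w2 a (Finset.mem_insert_self a A)).1 h)),
    if_pos ((w4 a (Finset.mem_insert_self a A)).2 (Finset.mem_insert_self a B))]
  rw [Finset.prod_congr rfl fun c hc => if_congr (h2 c hc) rfl rfl,
    Finset.prod_congr rfl fun c hc => if_congr (h4 c hc) rfl rfl]
  ring

theorem IsRado.edgeSum_subset (hE : IsRado E) (α : unitInterval) {A A' : Finset V} {S : Set V}
    (hS : Supports E A S) (hA : A ⊆ A') {v w : Finset V → V}
    (hv : IsEnumeration E A v) (hw : IsEnumeration E A' w) :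
    edgeSum E α A' w S = edgeSum E α A v S := by
  classical
  have main : ∀ D : Finset V, Disjoint D A → ∀ w, IsEnumeration E (D ∪ A) w →
      edgeSum E α (D ∪ A) w S = edgeSum E α A v S := by
    intro D
    induction D using Finset.induction_on with
    | empty =>
      intro _ w hw
      rw [Finset.empty_union] at hw ⊢
      unfold edgeSum
      refine Finset.sum_congr rfl fun B hB => ?_
      rw [Finset.mem_powerset] at hB
      have h : ∀ c ∈ A, (E.Adj (w B) c ↔ E.Adj (v B) c) := fun c hc => by
        rw [(hw B hB).2 c hc, (hv B hB).2 c hc]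
      rw [FSProb.indicator_congr (hE.mem_iff hS (hw B hB).1 (hv B hB).1 h) 1,
        Finset.prod_congr rfl fun c hc => if_congr (h c hc) rfl rfl]
    | insert a D haD ih =>
      intro hd w hw
      obtain ⟨w', hw'⟩ := hE.exists_enumeration (D ∪ A)
      rw [Finset.disjoint_insert_left] at hd
      rw [Finset.insert_union] at hw ⊢
      rw [hE.edgeSum_insert α (hS.mono Finset.subset_union_right)
        (by simp [haD, hd.1]) hw' hw, ih hd.2 w' hw']
  have h := main (A' \ A) Finset.sdiff_disjoint w
  rw [Finset.sdiff_union_of_subset hA] at h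
  exact h hw

/-- The sum does not depend on the choice of a support, nor on the choice of an enumeration. -/
theorem IsRado.edgeSum_eq (hE : IsRado E) (α : unitInterval) {A A' : Finset V} {S : Set V}
    (hS : Supports E A S) (hS' : Supports E A' S) {v w : Finset V → V}
    (hv : IsEnumeration E A v) (hw : IsEnumeration E A' w) :
    edgeSum E α A v S = edgeSum E α A' w S := by
  classical
  obtain ⟨u, hu⟩ := hE.exists_enumeration (A ∪ A')
  rw [← hE.edgeSum_subset α hS Finset.subset_union_left hv hu,
    hE.edgeSum_subset α hS' Finset.subset_union_right hw hu]

theorem edgeSum_smul (α : unitInterval) {A : Finset V} {S : Set V} {v : Finset V → V}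
    (σ : E ≃g E) (hv : IsEnumeration E A v) :
    ∃ w, IsEnumeration E (A.map σ.toEquiv.toEmbedding) w ∧
      edgeSum E α (A.map σ.toEquiv.toEmbedding) w (σ • S) = edgeSum E α A v S := by
  classical
  set e := σ.toEquiv.toEmbedding with he
  set e' := σ.symm.toEquiv.toEmbedding with he'
  have hee : ∀ B : Finset V, (B.map e).map e' = B := fun B => by
    ext x; simp only [Finset.mem_map_equiv, he, he']
    exact Iff.of_eq (congrArg (· ∈ B) (σ.symm_apply_apply x))
  have hee' : ∀ B : Finset V, (B.map e').map e = B := fun B => by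
    ext x; simp only [Finset.mem_map_equiv, he, he']
    exact Iff.of_eq (congrArg (· ∈ B) (σ.apply_symm_apply x))
  refine ⟨fun B => σ (v (B.map e')), fun B hB => ?_, ?_⟩
  · have hB' : B.map e' ⊆ A := by rw [← hee A]; exact Finset.map_subset_map.2 hB
    obtain ⟨h1, h2⟩ := hv _ hB'
    refine ⟨fun h => h1 ((Finset.mem_map' e).1 h), fun a ha => ?_⟩
    obtain ⟨a, ha', rfl⟩ := Finset.mem_map.1 ha
    refine (σ.map_adj_iff (v := v (B.map e')) (w := a)).trans ((h2 a ha').trans ?_)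
    conv_rhs => rw [← hee' B]
    exact (Finset.mem_map' e).symm
  · unfold edgeSum
    refine Finset.sum_nbij' (fun B => B.map e') (fun B => B.map e) ?_ ?_ ?_ ?_ ?_
    · intro B hB
      rw [Finset.mem_powerset] at hB ⊢
      rw [← hee A]; exact Finset.map_subset_map.2 hB
    · intro B hB
      rw [Finset.mem_powerset] at hB ⊢
      exact Finset.map_subset_map.2 hB
    · intro B _; exact hee' B
    · intro B _; exact hee B
    · intro B _
      rw [Finset.prod_map]
      congr 1
      · exact FSProb.indicator_congr Set.smul_mem_smul_set_iff _
      · exact Finset.prod_congr rfl fun a _ => if_congr σ.map_adj_iff rfl rfl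

/-- The value `ν_α(S) = ∑ⱼ [vⱼ ∈ S] ∏ᵢ (α E(vⱼ,aᵢ) + (1-α) (1 - E(vⱼ,aᵢ)))`, for a chosen support
`{a₁,…,aₙ}` of `S` and a chosen enumeration `v`. -/
noncomputable def edgeValue (hE : IsRado E) (α : unitInterval) (S : Event E V) : ℝ :=
  edgeSum E α S.2.choose (hE.exists_enumeration S.2.choose).choose S.1

/-- The defining formula of `ν_α` holds for every finite support of `S` and every enumeration. -/
theorem edgeValue_eq (hE : IsRado E) (α : unitInterval) {S : Event E V} {A : Finset V}
    {v : Finset V → V} (hA : Supports E A S.1) (hv : IsEnumeration E A v) :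
    edgeValue hE α S = edgeSum E α A v S.1 :=
  hE.edgeSum_eq α S.2.choose_spec hA (hE.exists_enumeration _).choose_spec hv

theorem supports_univ (A : Finset V) : Supports E A (Event.univ E V).1 :=
  supports_set_of fun _ _ _ _ => trivial

theorem edgeSum_univ (hE : IsRado E) (α : unitInterval) {A : Finset V} {v : Finset V → V}
    (hv : IsEnumeration E A v) : edgeSum E α A v Set.univ = 1 := by
  obtain ⟨w, hw⟩ := hE.exists_enumeration ∅
  have h := hE.edgeSum_eq α (supports_univ A) (supports_univ ∅) hv hw
  refine h.trans ?_
  simp [edgeSum, Event.univ]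

theorem edgeValue_smul (hE : IsRado E) (α : unitInterval) (σ : E ≃g E) (S : Event E V) :
    edgeValue hE α (σ • S) = edgeValue hE α S := by
  obtain ⟨A, hA⟩ := S.2
  obtain ⟨v, hv⟩ := hE.exists_enumeration A
  obtain ⟨w, hw, h⟩ := edgeSum_smul (S := S.1) α σ hv
  rw [edgeValue_eq hE α hA hv, ← h]
  exact edgeValue_eq hE α (hA.smul σ) hw

/-- The measure `ν_α` on the vertices of the Rado graph. -/
noncomputable def edgeMeasure (hE : IsRado E) (α : unitInterval) : FSProb E V where
  toFun S := ⟨edgeValue hE α S, edgeSum_nonneg _ _ _ _,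
    (edgeSum_mono _ _ _ _).trans (edgeSum_univ hE α (hE.exists_enumeration _).choose_spec).le⟩
  finSupp' := ⟨∅, fun σ _ S => Subtype.ext (edgeValue_smul hE α σ S)⟩
  additive' := by
    rintro S U ⟨A, hA⟩ hd hU
    change HasSum (fun i => edgeValue hE α (S i)) (edgeValue hE α U)
    have hUA : Supports E A U.1 := hU ▸ (supportedSets E V A).measurableSet_iUnion _ hA
    obtain ⟨v, hv⟩ := hE.exists_enumeration A
    rw [edgeValue_eq hE α hUA hv]
    simp_rw [edgeValue_eq hE α (hA _) hv]
    refine hasSum_sum fun B _ => HasSum.mul_right _ ?_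
    have hx : FinSupp E (v B) := ⟨{v B}, fun σ hσ => hσ _ (Finset.mem_singleton_self _)⟩
    exact (FSProb.dirac (v B) hx).additive' S U ⟨A, hA⟩ hd hU
  total' := Subtype.ext
    (edgeSum_univ hE α (hE.exists_enumeration _).choose_spec)

theorem smul_edgeMeasure (hE : IsRado E) (α : unitInterval) (σ : E ≃g E) :
    σ • edgeMeasure hE α = edgeMeasure hE α := by
  ext S
  exact edgeValue_smul hE α σ⁻¹ S

end RadoGraph

section Generators

variable {V : Type u} (E : SimpleGraph V)

open RadoNom

/-- The nominal set of vertices, with `σ • a = σ(a)`. -/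
def vertices : RadoNom E where
  carrier := V
  action := inferInstance
  finSupp v := ⟨{v}, fun _ hσ => hσ v (Finset.mem_singleton_self v)⟩

/-- The two-element set `2 = {0, 1}`, with the discrete action. -/
def two : RadoNom E := discrete E (ULift.{u} (Fin 2))

/-- The unit interval `[0,1]`, with the discrete action. -/
def interval : RadoNom E := discrete E (ULift.{u} unitInterval)

/-- The global element `ν_α : 1 ⟶ P(V)`. -/
noncomputable def nu {E : SimpleGraph V} (hE : IsRado E) (α : unitInterval) :
    𝟙_ (RadoNom E) ⟶ (probMonad E).obj (vertices E) :=
  show Hom (𝟙_ (RadoNom E)) (probObj E (vertices E)) from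
    ⟨fun _ => edgeMeasure hE α, fun σ _ => (smul_edgeMeasure hE α σ).symm⟩

/-- `bernoulli : [0,1] ⟶ P(2)`, `bernoulli(r) = r · η(0) + (1 - r) · η(1)`. -/
noncomputable def bernoulli : interval E ⟶ (probMonad E).obj (two E) :=
  let η : Hom (two E) (probObj E (two E)) := (probMonad E).η (two E)
  show Hom (interval E) (probObj E (two E)) from
    ⟨fun r => FSProb.mix r.down (η.toFun ⟨0⟩) (η.toFun ⟨1⟩), fun σ r =>
      (congrArg₂ (FSProb.mix r.down) (η.map_smul σ ⟨0⟩) (η.map_smul σ ⟨1⟩)).trans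
        (FSProb.smul_mix σ _ _ _).symm⟩

end Generators

end NominalProb

/-!
The submonad is generated by the Dirac measures, `ν_α` and the Bernoulli measures under the binds of
the ambient monad (`Generated`). Stating the closure under bind for equivariant families makes the
generated measures an equivariant subset of each `P(X)`, contained in every strong submonad through
which the generators factor; so they form the least one.

Commutativity is a Fubini property: two measures `μ`, `ν` commute if iterated integrals of finitely
supported functions on the product may be exchanged (`FSProb.Commutes`). This relation is symmetric,
and for fixed `ν` the measures that commute with `ν` contain the Dirac measures and are closed under
convex combinations and binds. By two inductions on generation, everything is thus reduced to the
fact that `ν_α` commutes with itself (`commutes_edgeMeasure`). For an integrand supported by `A`,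
the inner integral is supported by `A`, so both integrals become finite sums over the possible edges to
`A`, with one more factor `α` or `1 - α` for the edge between the two vertices. Homogeneity of the
Rado graph (`IsRado.apply_pair_eq`) shows that the integrand depends only on these edges, and the
weights are symmetric in the two vertices.

The monad is affine because a one-point set carries a single probability measure.
-/

namespace NominalProb

open CategoryTheory MonoidalCategory CartesianMonoidalCategory

universe u v w

/-! ### Equivariant subsets and subobjects -/

namespace RadoNom

variable {V : Type u} {E : SimpleGraph V}

/-- The nominal set of the elements of `X` that satisfy an equivariant predicate. -/
def sub (X : RadoNom E) (P : X → Prop) (hP : ∀ (σ : E ≃g E) x, P x → P (σ • x)) : RadoNom E where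
  carrier := {x : X // P x}
  action :=
    { smul := fun σ x => ⟨σ • x.1, hP σ x.1 x.2⟩
      one_smul := fun x => Subtype.ext (one_smul _ x.1)
      mul_smul := fun σ τ x => Subtype.ext (mul_smul σ τ x.1) }
  finSupp x := (X.finSupp x.1).imp fun _ hA σ hσ => Subtype.ext (hA σ hσ)

/-- The inclusion of an equivariant subset. -/
def subι (X : RadoNom E) (P : X → Prop) (hP : ∀ (σ : E ≃g E) x, P x → P (σ • x)) :
    X.sub P hP ⟶ X :=
  (⟨Subtype.val, fun _ _ => rfl⟩ : Hom (X.sub P hP) X)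

instance (X : RadoNom E) (P : X → Prop) (hP : ∀ (σ : E ≃g E) x, P x → P (σ • x)) :
    Mono (X.subι P hP) where
  right_cancellation _ _ h := hom_ext fun z =>
    Subtype.ext (congrArg (fun k : _ ⟶ X => k z) h)

/-- Monomorphisms are injective: their kernel pair is an equivariant subset of the product. -/
theorem injective_of_mono {X Y : RadoNom E} (m : X ⟶ Y) [Mono m] {x x' : X} (h : m x = m x') :
    x = x' := by
  let K := (prod X X).sub (fun p => m p.1 = m p.2) fun σ p hp => by
    change m (σ • p.1) = m (σ • p.2)
    rw [map_smul, map_smul, hp]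
  let p₁ : K ⟶ X := (⟨fun p => p.1.1, fun _ _ => rfl⟩ : Hom K X)
  let p₂ : K ⟶ X := (⟨fun p => p.1.2, fun _ _ => rfl⟩ : Hom K X)
  have hp : p₁ = p₂ := (cancel_mono m).1 (hom_ext fun p => p.2)
  exact congrArg (fun k : K ⟶ X => k ⟨(x, x'), h⟩) hp

theorem factors_iff {X Z : RadoNom E} (S : Subobject X) (f : Z ⟶ X) :
    S.Factors f ↔ ∀ z, ∃ s : (S : RadoNom E), S.arrow s = f z := by
  refine ⟨fun h z => ⟨S.factorThru f h z, ?_⟩, fun h => ?_⟩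
  · rw [← comp_apply, Subobject.factorThru_arrow]
  · choose g hg using h
    let g' : Z ⟶ (S : RadoNom E) := (⟨g, fun σ z => injective_of_mono S.arrow (by
      rw [hg, map_smul, map_smul, hg])⟩ : Hom _ _)
    exact (Subobject.factors_iff _ _).2 ⟨g', hom_ext hg⟩

theorem factors_mk_subι_iff {X Z : RadoNom E} (P : X → Prop)
    (hP : ∀ (σ : E ≃g E) x, P x → P (σ • x)) (f : Z ⟶ X) :
    (Subobject.mk (X.subι P hP)).Factors f ↔ ∀ z, P (f z) := by
  rw [Subobject.mk_factors_iff]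
  refine ⟨?_, fun h => ?_⟩
  · rintro ⟨g, rfl⟩ z
    exact (g z).2
  · exact ⟨(⟨fun z => ⟨f z, h z⟩, fun σ z => Subtype.ext (map_smul f σ z)⟩ :
      Hom Z (X.sub P hP)), rfl⟩

end RadoNom

/-! ### Finitely supported integrands -/

section Integrals

variable {V : Type u} {E : SimpleGraph V} {X : Type v} [MulAction (E ≃g E) X]
  {Y : Type w} [MulAction (E ≃g E) Y]

theorem Invariant.mono {R : Type*} {A B : Finset V} {f : X → R} (h : Invariant E A f)
    (hAB : A ⊆ B) : Invariant E B f := fun σ hσ => h σ (hσ.mono hAB)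

theorem Invariant.comp_left {R : Type*} {A B : Finset V} [DecidableEq V] {f : X × Y → R}
    (h : Invariant E A f) {x : X} (hx : Supports E B x) :
    Invariant E (A ∪ B) fun y => f (x, y) := fun σ hσ y => by
  have := h σ (hσ.mono Finset.subset_union_left) (x, y)
  rwa [Prod.smul_mk, hx σ (hσ.mono Finset.subset_union_right)] at this

theorem Invariant.swap {R : Type*} {A : Finset V} {f : X × Y → R} (h : Invariant E A f) :
    Invariant E A fun p : Y × X => f p.swap := fun σ hσ p => h σ hσ p.swap

namespace FSProb

/-- The integral of a `[0,1]`-valued function, as an element of `[0,1]`; in this form integrals can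
be iterated. -/
noncomputable def expect (μ : FSProb E X) (f : X → unitInterval) : unitInterval :=
  ⟨μ.integral f, μ.integral_nonneg f, μ.integral_le_one f⟩

theorem coe_expect (μ : FSProb E X) (f : X → unitInterval) : (μ.expect f : ℝ) = μ.integral f := rfl

theorem smul_expect (σ : E ≃g E) (μ : FSProb E X) (f : X → unitInterval) :
    (σ • μ).expect f = μ.expect fun x => f (σ • x) := Subtype.ext (integral_smul σ μ f)

theorem expect_bind (μ : FSProb E X) (k : X → FSProb E Y) (hk : ∃ A, SupportsFun E A k)
    {f : Y → unitInterval} (hf : ∃ A, Invariant E A f) :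
    (μ.bind k hk).expect f = μ.expect fun x => (k x).expect f :=
  Subtype.ext (integral_bind μ k hk hf)

theorem expect_dirac (x : X) (hx : FinSupp E x) {f : X → unitInterval}
    (hf : ∃ A, Invariant E A f) : (dirac x hx).expect f = f x :=
  Subtype.ext (integral_dirac x hx hf)

/-- Integrating out one variable with a supported kernel preserves supports. -/
theorem invariant_expect {k : X → FSProb E Y} {A : Finset V} (hk : SupportsFun E A k)
    {f : X × Y → unitInterval} (hf : Invariant E A f) :
    Invariant E A fun x => (k x).expect fun y => f (x, y) := fun σ hσ x => by
  change (k (σ • x)).expect _ = _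
  rw [hk σ hσ, smul_expect]
  congr 1
  ext y
  exact congrArg _ (hf σ hσ (x, y))

theorem exists_invariant_expect {k : X → FSProb E Y} (hk : ∃ A, SupportsFun E A k)
    {f : X × Y → unitInterval} (hf : ∃ A, Invariant E A f) :
    ∃ A, Invariant E A fun x => (k x).expect fun y => f (x, y) := by
  classical
  obtain ⟨A, hA⟩ := hf
  obtain ⟨B, hB⟩ := hk
  exact ⟨A ∪ B, invariant_expect (fun σ hσ => hB σ (hσ.mono Finset.subset_union_right))
    (hA.mono Finset.subset_union_left)⟩

theorem exists_supportsFun_const (ν : FSProb E Y) : ∃ A, SupportsFun E A fun _ : X => ν :=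
  ν.finSupp.imp fun _ hA σ hσ _ => (hA σ hσ).symm

theorem toMeasure_mix (r : unitInterval) (μ ν : FSProb E X) (A : Finset V) :
    (mix r μ ν).toMeasure A =
      ENNReal.ofReal r • μ.toMeasure A + ENNReal.ofReal (1 - r) • ν.toMeasure A := by
  let _ := supportedSets E X A
  refine MeasureTheory.Measure.ext fun S hS => ?_
  have h (ρ : FSProb E X) : ρ.toMeasure A S = ENNReal.ofReal (ρ ⟨S, A, hS⟩) :=
    ρ.toMeasure_apply (S := ⟨S, A, hS⟩) hS
  rw [MeasureTheory.Measure.add_apply, MeasureTheory.Measure.smul_apply,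
    MeasureTheory.Measure.smul_apply, h, h, h, smul_eq_mul, smul_eq_mul,
    ← ENNReal.ofReal_mul r.2.1, ← ENNReal.ofReal_mul (sub_nonneg.2 r.2.2), ← ENNReal.ofReal_add]
  · rfl
  · exact mul_nonneg r.2.1 (unitInterval.nonneg _)
  · exact mul_nonneg (sub_nonneg.2 r.2.2) (unitInterval.nonneg _)

theorem ofReal_convex (r : unitInterval) {a b : ℝ} (ha : 0 ≤ a) (hb : 0 ≤ b) :
    ENNReal.ofReal (r * a + (1 - r) * b) =
      ENNReal.ofReal r * ENNReal.ofReal a + ENNReal.ofReal (1 - r) * ENNReal.ofReal b := by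
  rw [← ENNReal.ofReal_mul r.2.1, ← ENNReal.ofReal_mul (sub_nonneg.2 r.2.2), ENNReal.ofReal_add
    (mul_nonneg r.2.1 ha) (mul_nonneg (sub_nonneg.2 r.2.2) hb)]

theorem convex_nonneg (r : unitInterval) {a b : ℝ} (ha : 0 ≤ a) (hb : 0 ≤ b) :
    0 ≤ r * a + (1 - r) * b :=
  add_nonneg (mul_nonneg r.2.1 ha) (mul_nonneg (sub_nonneg.2 r.2.2) hb)

theorem integral_mix (r : unitInterval) (μ ν : FSProb E X) {f : X → unitInterval}
    (hf : ∃ A, Invariant E A f) :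
    (mix r μ ν).integral f = r * μ.integral f + (1 - r) * ν.integral f := by
  obtain ⟨A, hA⟩ := hf
  let _ := supportedSets E X A
  rw [← ENNReal.ofReal_eq_ofReal_iff (integral_nonneg _ _)
    (convex_nonneg r (integral_nonneg _ _) (integral_nonneg _ _)),
    ofReal_convex r (integral_nonneg _ _) (integral_nonneg _ _),
    ofReal_integral _ hA, ofReal_integral _ hA, ofReal_integral _ hA, toMeasure_mix,
    MeasureTheory.lintegral_add_measure, MeasureTheory.lintegral_smul_measure,
    MeasureTheory.lintegral_smul_measure, smul_eq_mul, smul_eq_mul]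

theorem measurable_ofReal_invariant {f : X → unitInterval} {A : Finset V} (hf : Invariant E A f) :
    @Measurable X ENNReal (supportedSets E X A) _ fun x => ENNReal.ofReal (f x) :=
  (ENNReal.measurable_ofReal.comp measurable_subtype_coe).comp hf.measurable

theorem integral_convex (r : unitInterval) (μ : FSProb E X) {f g h : X → unitInterval}
    (hf : ∃ A, Invariant E A f) (hg : ∃ A, Invariant E A g)
    (hh : ∀ x, (h x : ℝ) = r * f x + (1 - r) * g x) :
    μ.integral h = r * μ.integral f + (1 - r) * μ.integral g := by
  classical
  obtain ⟨A', hA'⟩ := hf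
  obtain ⟨B, hB⟩ := hg
  obtain ⟨A, hfA, hgA⟩ : ∃ A, Invariant E A f ∧ Invariant E A g :=
    ⟨A' ∪ B, hA'.mono Finset.subset_union_left, hB.mono Finset.subset_union_right⟩
  have hhA : Invariant E A h := fun σ hσ x =>
    Subtype.ext (by rw [hh, hh, hfA σ hσ, hgA σ hσ])
  let _ := supportedSets E X A
  rw [← ENNReal.ofReal_eq_ofReal_iff (integral_nonneg _ _)
    (convex_nonneg r (integral_nonneg _ _) (integral_nonneg _ _)),
    ofReal_convex r (integral_nonneg _ _) (integral_nonneg _ _),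
    ofReal_integral _ hfA, ofReal_integral _ hgA, ofReal_integral _ hhA]
  simp_rw [hh, ofReal_convex r (unitInterval.nonneg _) (unitInterval.nonneg _)]
  rw [MeasureTheory.lintegral_add_left ((measurable_ofReal_invariant hfA).const_mul _),
    MeasureTheory.lintegral_const_mul _ (measurable_ofReal_invariant hfA),
    MeasureTheory.lintegral_const_mul _ (measurable_ofReal_invariant hgA)]

/-! ### Commuting measures -/

/-- Two measures commute if the order of integration may be exchanged for all finitely supported
integrands on the product. -/
def Commutes (μ : FSProb E X) (ν : FSProb E Y) : Prop :=
  ∀ f : X × Y → unitInterval, (∃ A, Invariant E A f) →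
    (μ.expect fun x => ν.expect fun y => f (x, y)) =
      ν.expect fun y => μ.expect fun x => f (x, y)

theorem Commutes.symm {μ : FSProb E X} {ν : FSProb E Y} (h : Commutes μ ν) : Commutes ν μ :=
  fun f hf => (h (fun p => f p.swap) (hf.imp fun _ => Invariant.swap)).symm

theorem exists_invariant_left {f : X × Y → unitInterval} (hf : ∃ A, Invariant E A f) {x : X}
    (hx : FinSupp E x) : ∃ A, Invariant E A fun y => f (x, y) := by
  classical
  obtain ⟨A, hA⟩ := hf
  obtain ⟨B, hB⟩ := hx
  exact ⟨A ∪ B, hA.comp_left hB⟩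

theorem exists_invariant_right {f : X × Y → unitInterval} (hf : ∃ A, Invariant E A f) {y : Y}
    (hy : FinSupp E y) : ∃ A, Invariant E A fun x => f (x, y) :=
  exists_invariant_left (f := fun p : Y × X => f p.swap) (hf.imp fun _ => Invariant.swap) hy

theorem commutes_dirac (x : X) (hx : FinSupp E x) (hY : ∀ y : Y, FinSupp E y) (ν : FSProb E Y) :
    Commutes (dirac x hx) ν := fun f hf => by
  rw [expect_dirac x hx (exists_invariant_expect (exists_supportsFun_const ν) hf)]
  congr 1
  ext y
  rw [expect_dirac x hx (exists_invariant_right hf (hY y))]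

theorem Commutes.mix (r : unitInterval) {μ μ' : FSProb E X} {ν : FSProb E Y}
    (hY : ∀ y : Y, FinSupp E y) (h : Commutes μ ν) (h' : Commutes μ' ν) :
    Commutes (mix r μ μ') ν := fun f hf => by
  have hf' : ∃ A, Invariant E A fun p : Y × X => f p.swap := hf.imp fun _ => Invariant.swap
  refine Subtype.ext ?_
  rw [coe_expect, coe_expect,
    integral_mix r μ μ' (exists_invariant_expect (exists_supportsFun_const ν) hf),
    integral_convex r ν (exists_invariant_expect (exists_supportsFun_const μ) hf')
      (exists_invariant_expect (exists_supportsFun_const μ') hf')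
      fun y => integral_mix r μ μ' (exists_invariant_right hf (hY y))]
  exact congrArg₂ (fun a b : unitInterval => (r * a + (1 - r) * b : ℝ)) (h f hf) (h' f hf)

theorem Commutes.bind {Z : Type*} [MulAction (E ≃g E) Z] {μ : FSProb E Z} {ν : FSProb E Y}
    {k : Z → FSProb E X} (hk : ∃ A, SupportsFun E A k) (hY : ∀ y : Y, FinSupp E y)
    (hμ : Commutes μ ν) (h : ∀ z, Commutes (k z) ν) : Commutes (μ.bind k hk) ν := fun f hf => by
  have hkf : ∃ A, Invariant E A fun p : Z × Y => (k p.1).expect fun x => f (x, p.2) := by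
    obtain ⟨A, hA⟩ := hk
    obtain ⟨B, hB⟩ := hf
    refine exists_invariant_expect (k := fun p : Z × Y => k p.1)
      (f := fun q : (Z × Y) × X => f (q.2, q.1.2)) ⟨A, fun σ hσ p => hA σ hσ p.1⟩
      ⟨B, fun σ hσ q => hB σ hσ (q.2, q.1.2)⟩
  calc (μ.bind k hk).expect (fun x => ν.expect fun y => f (x, y))
      = μ.expect fun z => (k z).expect fun x => ν.expect fun y => f (x, y) :=
        expect_bind μ k hk (exists_invariant_expect (exists_supportsFun_const ν) hf)
    _ = μ.expect fun z => ν.expect fun y => (k z).expect fun x => f (x, y) := by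
        simp_rw [h _ f hf]
    _ = ν.expect fun y => μ.expect fun z => (k z).expect fun x => f (x, y) := hμ _ hkf
    _ = ν.expect fun y => (μ.bind k hk).expect fun x => f (x, y) := by
        congr 1
        ext y
        rw [expect_bind μ k hk (exists_invariant_right hf (hY y))]

end FSProb

end Integrals

/-! ### The edge measure commutes with itself -/

section EdgeMeasure

open FSProb

variable {V : Type u} {E : SimpleGraph V}

/-- The probability that a random vertex is adjacent to exactly those elements of `A` that are
in `B`. -/
noncomputable def edgeWeight [DecidableEq V] (α : unitInterval) (A B : Finset V) : ℝ :=
  ∏ a ∈ A, if a ∈ B then (α : ℝ) else 1 - α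

theorem edgeWeight_nonneg [DecidableEq V] (α : unitInterval) (A B : Finset V) :
    0 ≤ edgeWeight α A B :=
  Finset.prod_nonneg fun _ _ => by split_ifs; exacts [α.2.1, sub_nonneg.2 α.2.2]

theorem edgeSum_eq_weight [DecidableEq V] (α : unitInterval) {A : Finset V}
    {v : Finset V → V} (hv : IsEnumeration E A v) (S : Set V) :
    edgeSum E α A v S =
      ∑ B ∈ A.powerset, S.indicator (fun _ => (1 : ℝ)) (v B) * edgeWeight α A B := by
  classical
  refine Finset.sum_congr rfl fun B hB => congrArg _ (Finset.prod_congr rfl fun a ha => ?_)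
  exact if_congr ((hv B (Finset.mem_powerset.1 hB)).2 a ha) rfl rfl

/-- On the sets supported by `A`, the edge measure is concentrated on finitely many points. -/
theorem toMeasure_edgeMeasure [DecidableEq V] (hE : IsRado E) (α : unitInterval) {A : Finset V}
    {v : Finset V → V} (hv : IsEnumeration E A v) :
    (edgeMeasure hE α).toMeasure A =
      ∑ B ∈ A.powerset, ENNReal.ofReal (edgeWeight α A B) •
        @MeasureTheory.Measure.dirac V (supportedSets E V A) (v B) := by
  let _ := supportedSets E V A
  refine MeasureTheory.Measure.ext fun S hS => ?_
  rw [MeasureTheory.Measure.finsetSum_apply]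
  refine ((edgeMeasure hE α).toMeasure_apply (S := ⟨S, A, hS⟩) hS).trans ?_
  change ENNReal.ofReal (edgeValue hE α _) = _
  rw [edgeValue_eq hE α (S := ⟨S, A, hS⟩) hS hv, edgeSum_eq_weight α hv,
    ENNReal.ofReal_sum_of_nonneg fun B _ =>
      mul_nonneg (Set.indicator_nonneg (fun _ _ => zero_le_one) _) (edgeWeight_nonneg α A B)]
  refine Finset.sum_congr rfl fun B _ => ?_
  rw [MeasureTheory.Measure.smul_apply, MeasureTheory.Measure.dirac_apply' _ hS, smul_eq_mul]
  by_cases h : v B ∈ S <;> simp [h]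

theorem integral_edgeMeasure [DecidableEq V] (hE : IsRado E) (α : unitInterval)
    {A : Finset V} {v : Finset V → V} (hv : IsEnumeration E A v) {f : V → unitInterval}
    (hf : Invariant E A f) :
    (edgeMeasure hE α).integral f = ∑ B ∈ A.powerset, edgeWeight α A B * f (v B) := by
  have h0 : ∀ B ∈ A.powerset, 0 ≤ edgeWeight α A B * f (v B) := fun B _ =>
    mul_nonneg (edgeWeight_nonneg α A B) (unitInterval.nonneg _)
  let _ := supportedSets E V A
  rw [← ENNReal.ofReal_eq_ofReal_iff (integral_nonneg _ _) (Finset.sum_nonneg h0),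
    ofReal_integral _ hf, toMeasure_edgeMeasure hE α hv, MeasureTheory.lintegral_finsetSum_measure,
    ENNReal.ofReal_sum_of_nonneg h0]
  refine Finset.sum_congr rfl fun B _ => ?_
  rw [MeasureTheory.lintegral_smul_measure, MeasureTheory.lintegral_dirac'
    _ (measurable_ofReal_invariant hf), smul_eq_mul, ENNReal.ofReal_mul (edgeWeight_nonneg α A B)]

/-- Over a support `A` and a vertex `a ∉ A`, a random vertex is adjacent to `a` with probability `α`
independently of its edges to `A`. -/
theorem integral_edgeMeasure_insert [DecidableEq V] (hE : IsRado E) (α : unitInterval)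
    {A : Finset V} {a : V} (ha : a ∉ A) {w : Finset V → V} (hw : IsEnumeration E (insert a A) w)
    {f : V → unitInterval} (hf : Invariant E (insert a A) f) :
    (edgeMeasure hE α).integral f = ∑ B ∈ A.powerset,
      edgeWeight α A B * ((1 - α) * f (w B) + α * f (w (insert a B))) := by
  rw [integral_edgeMeasure hE α hw hf, Finset.sum_powerset_insert ha, ← Finset.sum_add_distrib]
  refine Finset.sum_congr rfl fun B hB => ?_
  have haB : a ∉ B := fun h => ha (Finset.mem_powerset.1 hB h)
  have h : edgeWeight α A (insert a B) = edgeWeight α A B := by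
    refine Finset.prod_congr rfl fun c hc => if_congr ?_ rfl rfl
    rw [Finset.mem_insert, or_iff_right fun e : c = a => ha (e ▸ hc)]
  have h1 : edgeWeight α (insert a A) B = (1 - α) * edgeWeight α A B := by
    unfold edgeWeight
    rw [Finset.prod_insert ha, if_neg haB]
  have h2 : edgeWeight α (insert a A) (insert a B) = α * edgeWeight α A B := by
    rw [← h]
    unfold edgeWeight
    rw [Finset.prod_insert ha, if_pos (Finset.mem_insert_self a B)]
  rw [h1, h2]
  ring

/-- Functions on pairs of distinct vertices that are supported by `A` depend only on the edges
between the two vertices and from them to `A`. -/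
theorem IsRado.apply_pair_eq (hE : IsRado E) {R : Type*} {A : Finset V} {f : V × V → R}
    (hf : Invariant E A f) {x y x' y' : V} (hx : x ∉ A) (hx' : x' ∉ A) (hy : y ∉ A)
    (hy' : y' ∉ A) (hxy : x ≠ y) (hxy' : x' ≠ y') (h1 : ∀ a ∈ A, E.Adj x a ↔ E.Adj x' a)
    (h2 : ∀ a ∈ A, E.Adj y a ↔ E.Adj y' a) (h3 : E.Adj x y ↔ E.Adj x' y') :
    f (x, y) = f (x', y') := by
  classical
  obtain ⟨σ, hσ, rfl⟩ := hE.exists_fixing hx hx' h1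
  have hσA : ∀ a ∈ A, (σ y = a ↔ y = a) ∧ (E.Adj (σ y) a ↔ E.Adj y a) := fun a ha => by
    have h7 : σ y = σ a ↔ y = a := σ.injective.eq_iff
    have h8 : E.Adj (σ y) (σ a) ↔ E.Adj y a := σ.map_adj_iff
    rw [hσ a ha] at h7 h8
    exact ⟨h7, h8⟩
  have h4 : σ y ∉ insert (σ x) A := fun h => by
    rcases Finset.mem_insert.1 h with h | h
    · exact hxy (σ.injective h).symm
    · exact hy (((hσA _ h).1.1 rfl) ▸ h)
  have h5 : y' ∉ insert (σ x) A := fun h => by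
    rcases Finset.mem_insert.1 h with h | h
    · exact hxy' h.symm
    · exact hy' h
  obtain ⟨τ, hτ, h6⟩ := hE.exists_fixing h4 h5 fun a ha => by
    rcases Finset.mem_insert.1 ha with rfl | ha
    · rw [σ.map_adj_iff, E.adj_comm, h3, E.adj_comm]
    · rw [(hσA a ha).2, h2 a ha]
  have h7 := hf τ (hτ.mono (Finset.subset_insert _ _)) (σ x, σ y)
  have h8 := hf σ hσ (x, y)
  rw [← h8, ← h6]
  refine h7.symm.trans ?_
  change f (τ (σ x), τ (σ y)) = _
  rw [hτ _ (Finset.mem_insert_self _ _)]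

/-- Sampling two vertices in either order gives the same joint distribution: it is determined by
the independent edges of both vertices to a support and by one further edge between them. -/
theorem commutes_edgeMeasure (hE : IsRado E) (α : unitInterval) :
    Commutes (edgeMeasure hE α) (edgeMeasure hE α) := by
  classical
  rintro f ⟨A, hA⟩
  obtain ⟨v, hv⟩ := hE.exists_enumeration A
  choose w hw using fun B => hE.exists_enumeration (insert (v B) A)
  have hl : ∀ f : V × V → unitInterval, Invariant E A f → ∀ x,
      Invariant E (insert x A) fun y => f (x, y) := fun f hf x => by
    rw [Finset.insert_eq, Finset.union_comm]
    exact hf.comp_left fun σ hσ => hσ x (Finset.mem_singleton_self x)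
  have main : ∀ f : V × V → unitInterval, Invariant E A f →
      (edgeMeasure hE α).integral (fun x => (edgeMeasure hE α).expect fun y => f (x, y)) =
        ∑ B ∈ A.powerset, ∑ C ∈ A.powerset, edgeWeight α A B * (edgeWeight α A C *
          ((1 - α) * f (v B, w B C) + α * f (v B, w B (insert (v B) C)))) := fun f hf => by
    rw [integral_edgeMeasure hE α hv (invariant_expect (k := fun _ => edgeMeasure hE α)
      (fun σ _ _ => (smul_edgeMeasure hE α σ).symm) hf)]
    refine Finset.sum_congr rfl fun B hB => ?_
    rw [coe_expect, integral_edgeMeasure_insert hE α (hv B (Finset.mem_powerset.1 hB)).1 (hw B)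
      (hl f hf _), Finset.mul_sum]
  refine Subtype.ext ?_
  refine (main f hA).trans (Eq.trans ?_ (main (fun p => f p.swap) hA.swap).symm)
  rw [Finset.sum_comm]
  refine Finset.sum_congr rfl fun C hC => Finset.sum_congr rfl fun B hB => ?_
  rw [Finset.mem_powerset] at hB hC
  -- the vertices `w B C` and `w B (insert (v B) C)` realize the edges `C` over `A`, without and
  -- with an edge to `v B`
  have hw0 : ∀ {B C}, B ⊆ A → C ⊆ A → w B C ∉ A ∧ v B ≠ w B C ∧
      (∀ a ∈ A, E.Adj (w B C) a ↔ a ∈ C) ∧ ¬ E.Adj (v B) (w B C) := fun {B C} hB hC => by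
    obtain ⟨h1, h2⟩ := hw B C (hC.trans (Finset.subset_insert _ _))
    rw [Finset.mem_insert, not_or] at h1
    refine ⟨h1.2, Ne.symm h1.1, fun a ha => h2 a (Finset.mem_insert_of_mem ha), fun h => ?_⟩
    exact (hv B hB).1 (hC ((h2 _ (Finset.mem_insert_self _ _)).1 h.symm))
  have hw1 : ∀ {B C}, B ⊆ A → C ⊆ A → w B (insert (v B) C) ∉ A ∧ v B ≠ w B (insert (v B) C) ∧
      (∀ a ∈ A, E.Adj (w B (insert (v B) C)) a ↔ a ∈ C) ∧
        E.Adj (v B) (w B (insert (v B) C)) := fun {B C} hB hC => by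
    obtain ⟨h1, h2⟩ := hw B (insert (v B) C) (Finset.insert_subset_insert _ hC)
    rw [Finset.mem_insert, not_or] at h1
    refine ⟨h1.2, Ne.symm h1.1, fun a ha => ?_, ?_⟩
    · rw [h2 a (Finset.mem_insert_of_mem ha), Finset.mem_insert,
        or_iff_right fun e : a = v B => (hv B hB).1 (e ▸ ha)]
    · exact ((h2 _ (Finset.mem_insert_self _ _)).2 (Finset.mem_insert_self _ _)).symm
  have e0 : f (v B, w B C) = f (w C B, v C) := by
    obtain ⟨a1, a2, a3, a4⟩ := hw0 hB hC
    obtain ⟨b1, b2, b3, b4⟩ := hw0 hC hB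
    exact hE.apply_pair_eq hA (hv B hB).1 b1 a1 (hv C hC).1 a2 b2.symm
      (fun a ha => ((hv B hB).2 a ha).trans (b3 a ha).symm)
      (fun a ha => (a3 a ha).trans ((hv C hC).2 a ha).symm)
      (iff_of_false a4 fun h => b4 h.symm)
  have e1 : f (v B, w B (insert (v B) C)) = f (w C (insert (v C) B), v C) := by
    obtain ⟨a1, a2, a3, a4⟩ := hw1 hB hC
    obtain ⟨b1, b2, b3, b4⟩ := hw1 hC hB
    exact hE.apply_pair_eq hA (hv B hB).1 b1 a1 (hv C hC).1 a2 b2.symm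
      (fun a ha => ((hv B hB).2 a ha).trans (b3 a ha).symm)
      (fun a ha => (a3 a ha).trans ((hv C hC).2 a ha).symm)
      (iff_of_true a4 b4.symm)
  rw [e0, e1, Prod.swap_prod_mk, Prod.swap_prod_mk]
  ring

end EdgeMeasure

/-! ### The least strong submonad -/

section Generated

open RadoNom

variable {V : Type u} {E : SimpleGraph V}

/-- The measures obtained from Dirac measures, `ν_α` and `bernoulli` by repeated binds. -/
inductive Generated (hE : IsRado E) (α : unitInterval) :
    ∀ X : RadoNom E, (probMonad E).obj X → Prop
  | unit (X : RadoNom E) (x : X) : Generated hE α X ((probMonad E).η X x)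
  | nu (z : (𝟙_ (RadoNom E) : RadoNom E)) : Generated hE α (vertices E) (nu hE α z)
  | bernoulli (r : interval E) : Generated hE α (two E) (bernoulli E r)
  | bind {Z X Y : RadoNom E} (f : Z ⟶ (probMonad E).obj X) (g : Z ⊗ X ⟶ (probMonad E).obj Y)
      (hf : ∀ z, Generated hE α X (f z)) (hg : ∀ p, Generated hE α Y (g p)) (z : Z) :
      Generated hE α Y ((probMonad E).bind f g z)

variable {hE : IsRado E} {α : unitInterval}

theorem Generated.smul (σ : E ≃g E) {X : RadoNom E} {μ : (probMonad E).obj X}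
    (h : Generated hE α X μ) : Generated hE α X (σ • μ) := by
  cases h with
  | unit X x => rw [← map_smul]; exact .unit _ _
  | nu z => rw [← map_smul]; exact .nu _
  | bernoulli r => rw [← map_smul]; exact .bernoulli _
  | bind f g hf hg z => rw [← map_smul]; exact .bind f g hf hg _

theorem Generated.commutes_edgeMeasure {X : RadoNom E} {μ : (probMonad E).obj X}
    (h : Generated hE α X μ) :
    FSProb.Commutes (X := X) (Y := vertices E) μ (edgeMeasure hE α) := by
  induction h with
  | unit X x => exact FSProb.commutes_dirac x (X.finSupp x) (vertices E).finSupp _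
  | nu z => exact NominalProb.commutes_edgeMeasure hE α
  | bernoulli r =>
    exact FSProb.Commutes.mix _ (vertices E).finSupp
      (FSProb.commutes_dirac _ ((two E).finSupp _) (vertices E).finSupp _)
      (FSProb.commutes_dirac _ ((two E).finSupp _) (vertices E).finSupp _)
  | @bind Z X Y f g _ _ z hf hg =>
    exact FSProb.Commutes.bind (supportsFun_curry g z) (vertices E).finSupp (hf z)
      fun x => hg (pair z x)

theorem Generated.commutes {X Y : RadoNom E} {μ : (probMonad E).obj X} {ν : (probMonad E).obj Y}
    (hμ : Generated hE α X μ) (hν : Generated hE α Y ν) :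
    FSProb.Commutes (X := X) (Y := Y) μ ν := by
  induction hμ with
  | unit X x => exact FSProb.commutes_dirac x (X.finSupp x) Y.finSupp _
  | nu z => exact hν.commutes_edgeMeasure.symm
  | bernoulli r =>
    exact FSProb.Commutes.mix _ Y.finSupp
      (FSProb.commutes_dirac _ ((two E).finSupp _) Y.finSupp _)
      (FSProb.commutes_dirac _ ((two E).finSupp _) Y.finSupp _)
  | @bind Z X Y' f g _ _ z hf hg =>
    exact FSProb.Commutes.bind (supportsFun_curry g z) Y.finSupp (hf z) fun x => hg (pair z x)

variable (hE α) in
/-- The strong submonad of the generated measures. -/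
noncomputable def generatedSubmonad : StrongSubmonad (probMonad E) where
  obj X := Subobject.mk (((probMonad E).obj X).subι (Generated hE α X) fun σ _ => Generated.smul σ)
  η_factors X := (factors_mk_subι_iff _ _ _).2 (.unit X)
  bind_factors f g hf hg := (factors_mk_subι_iff _ _ _).2
    (.bind f g ((factors_mk_subι_iff _ _ _).1 hf) ((factors_mk_subι_iff _ _ _).1 hg))

theorem generatedSubmonad_factors_iff {X Z : RadoNom E} (f : Z ⟶ (probMonad E).obj X) :
    ((generatedSubmonad hE α).obj X).Factors f ↔ ∀ z, Generated hE α X (f z) :=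
  factors_mk_subι_iff _ _ _

theorem Generated.mem_of_factors {S : StrongSubmonad (probMonad E)}
    (hν : (S.obj (vertices E)).Factors (NominalProb.nu hE α))
    (hb : (S.obj (two E)).Factors (NominalProb.bernoulli E)) {X : RadoNom E}
    {μ : (probMonad E).obj X} (h : Generated hE α X μ) :
    ∃ s : (S.obj X : RadoNom E), (S.obj X).arrow s = μ := by
  induction h with
  | unit X x => exact (factors_iff _ _).1 (S.η_factors X) x
  | nu z => exact (factors_iff _ _).1 hν z
  | bernoulli r => exact (factors_iff _ _).1 hb r
  | bind f g _ _ z hf hg =>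
    exact (factors_iff _ _).1
      (S.bind_factors f g ((factors_iff _ _).2 hf) ((factors_iff _ _).2 hg)) z

theorem generatedSubmonad_le {S : StrongSubmonad (probMonad E)}
    (hν : (S.obj (vertices E)).Factors (NominalProb.nu hE α))
    (hb : (S.obj (two E)).Factors (bernoulli E)) : generatedSubmonad hE α ≤ S := fun _ =>
  Subobject.mk_le_of_comm (Subobject.factorThru _ _
    ((factors_iff _ _).2 fun μ : RadoNom.sub _ _ _ => μ.2.mem_of_factors hν hb))
    (Subobject.factorThru_arrow _ _ _)

/-- Morphisms into the probability monad commute as soon as their values do. -/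
theorem commute_of_commutes {X₁ X₂ X₃ : RadoNom E} (f : X₁ ⟶ (probMonad E).obj X₂)
    (g : X₁ ⟶ (probMonad E).obj X₃)
    (h : ∀ x, FSProb.Commutes (X := X₂) (Y := X₃) (f x) (g x)) : (probMonad E).Commute f g := by
  refine hom_ext fun x => FSProb.ext fun S => ?_
  exact h x (fun p => FSProb.dirac (X := (X₂ ⊗ X₃ : RadoNom E)) (pair p.1 p.2)
    (RadoNom.finSupp _ _) S) (S.2.imp fun A hA => FSProb.invariant_kernel
      (X := X₂ × X₃) (k := fun p => FSProb.dirac (X := (X₂ ⊗ X₃ : RadoNom E)) (pair p.1 p.2)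
        (RadoNom.finSupp _ _)) (fun σ _ p => (FSProb.smul_dirac σ _ _ _).symm) hA)

theorem generatedSubmonad_isCommutative :
    (generatedSubmonad hE α).toStrongMonad.IsCommutative := fun {_ X₂ X₃} f g => by
  have h := commute_of_commutes (f ≫ ((generatedSubmonad hE α).obj X₂).arrow)
    (g ≫ ((generatedSubmonad hE α).obj X₃).arrow) fun x =>
      ((generatedSubmonad_factors_iff _).1 (Subobject.factors_comp_arrow f) x).commutes
        ((generatedSubmonad_factors_iff _).1 (Subobject.factors_comp_arrow g) x)
  refine (cancel_mono ((generatedSubmonad hE α).obj (X₂ ⊗ X₃)).arrow).1 ?_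
  simp only [StrongSubmonad.toStrongMonad, Subobject.factorThru_arrow,
    Category.assoc]
  -- both sides now agree up to associativity of composition, which is definitional in `RadoNom`
  exact h

/-- A one-point set carries only one probability measure. -/
theorem FSProb.eq_of_subsingleton {X : Type v} [MulAction (E ≃g E) X] [Subsingleton X]
    (μ ν : FSProb E X) : μ = ν := by
  ext S
  rcases S.1.eq_empty_or_nonempty with h | h
  · rw [μ.empty h, ν.empty h]
  · obtain rfl : S = Event.univ E X := Subtype.ext (Subsingleton.eq_univ_of_nonempty h)
    rw [μ.total', ν.total']

theorem generatedSubmonad_isAffine : (generatedSubmonad hE α).toStrongMonad.IsAffine := by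
  let S := (generatedSubmonad hE α).obj (𝟙_ (RadoNom E))
  refine ⟨(generatedSubmonad hE α).toStrongMonad.η (𝟙_ (RadoNom E)), ?_, toUnit_unique _ _⟩
  refine (cancel_mono S.arrow).1 (hom_ext fun s => ?_)
  have : Subsingleton (𝟙_ (RadoNom E) : RadoNom E) := inferInstanceAs (Subsingleton PUnit)
  exact FSProb.eq_of_subsingleton (X := (𝟙_ (RadoNom E) : RadoNom E)) _ _

end Generated

end NominalProb

theorem corollary6p9 {V : Type*} (E : SimpleGraph V) (hE : NominalProb.IsRado E)
    (α : unitInterval) :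
    ∃ Pα : NominalProb.StrongSubmonad (NominalProb.probMonad E),
      IsLeast {S : NominalProb.StrongSubmonad (NominalProb.probMonad E) |
          (S.obj (NominalProb.vertices E)).Factors (NominalProb.nu hE α) ∧
          (S.obj (NominalProb.two E)).Factors (NominalProb.bernoulli E)} Pα ∧
        Pα.toStrongMonad.IsCommutative ∧ Pα.toStrongMonad.IsAffine :=
  ⟨NominalProb.generatedSubmonad hE α,
    ⟨⟨(NominalProb.generatedSubmonad_factors_iff _).2 .nu,
      (NominalProb.generatedSubmonad_factors_iff _).2 .bernoulli⟩,
      fun _ hS => NominalProb.generatedSubmonad_le hS.1 hS.2⟩,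
    NominalProb.generatedSubmonad_isCommutative, NominalProb.generatedSubmonad_isAffine⟩
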